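/- **Setting.** Let $M=(\mathcal X,\mathcal A,P,R,H,d_1)$ be an episodic MDP with countable $\mathcal X,\mathcal A$, horizon $H\ge 1$, and reward distributions $R_h(x,a)$ on $[0,1]$, such that $\sum_{h=1}^H r_h\in[0,1]$ almost surely under every policy. For a (randomized, Markov) policy $\pi$ let $J(\pi)=\mathbb E^\pi[\sum_h r_h]$ and $d^\pi_h(x,a)=\mathbb P^\pi[x_h=x,a_h=a]$. Let $\pi^\star$ be an optimal deterministic policy (maximizing $V_h^\pi(x)$ for all $h,x$) and $Q^\star_h(x,a)=\mathbb E^{\pi^\star}[\sum_{h'\ge h}r_{h'}\mid x_h=x,a_h=a]$. Let $\mathcal F$ be a finite class of functions $f=(f_1,\dots,f_H)$, $f_h:\mathcal X\times\mathcal A\to[0,1]$ (with $f_{H+1}:=0$), such that every $f_h(x,\cdot)$ attains its maximum; fix greedy policies $\pi_f$, $\pi_{f,h}(x)\in\arg\max_a f_h(x,a)$ (ties broken arbitrarily), and let $\Pi=\{\pi_f: f\in\mathcal F\}$. Let $\mathcal W$ be a finite class of weight functions $w=(w_1,\dots,w_H)$, $w_h:\mathcal X\times\mathcal A\to[0,\infty]$,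 and $\mathcal W_h=\{w_h:w\in\mathcal W\}$. With the conventions $p/0=\infty$ for $p>0$ and $0/0=1$, let $$C_{\mathsf{cov}}=\inf_{\mu_1,\dots,\mu_H\in\Delta(\mathcal X\times\mathcal A)}\ \sup_{\pi\in\Pi,\,h\in[H]}\Big\|\frac{d_h^\pi}{\mu_h}\Big\|_\infty .$$ Let $\delta\in(0,1)$ and $L=\log(|\mathcal F||\mathcal W|/\delta)$. **Algorithm (GLOW)** with parameters $T,K\ge 1$, $\gamma$. Put $\gamma^{(t)}=\gamma t$, $\alpha^{(t)}=8/\gamma^{(t)}$ and $\beta^{(t)}=\frac{36\gamma^{(t)}}{K(t-1)}\log(6|\mathcal F||\mathcal W|TH/\delta)$. In round $t=1,\dots,T$, let $\widehat{\mathbb E}$ be the empirical average over the $K(t-1)$ trajectories collected so far, and let $\mathcal F^{(t)}$ be the set of all $f\in\mathcal F$ such that for all $h\in[H]$ and $w\in\mathcal W_h$, with $\check w=\min\{w,\gamma^{(t)}\}$, $$\widehat{\mathbb E}\Big[\big(f_h(x_h,a_h)-r_h-\max_{a'}f_{h+1}(x_{h+1},a')\big)\,\check w(x_h,a_h)-\alpha^{(t)}\,\check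 w(x_h,a_h)^2\Big]\le\beta^{(t)}$$ (so $\mathcal F^{(1)}=\mathcal F$). Choose $f^{(t)}\in\arg\max_{f\in\mathcal F^{(t)}}\widehat{\mathbb E}[f_1(x_1,\pi_{f,1}(x_1))]$ as a measurable function of the data, with ties broken arbitrarily (an arbitrary element of $\mathcal F$ if $\mathcal F^{(t)}=\emptyset$), put $\pi^{(t)}=\pi_{f^{(t)}}$, and collect $K$ independent trajectories by executing $\pi^{(t)}$. The output is $\widehat\pi\sim\mathsf{Unif}(\pi^{(1)},\dots,\pi^{(T)})$, whose risk is $\mathbf{Risk}=\mathbb E_{\widehat\pi\sim\mathsf{Unif}(\pi^{(1)},\dots,\pi^{(T)})}[J(\pi^\star)-J(\widehat\pi)]$. **Assumptions.** (i) $Q^\star\in\mathcal F$. (ii) For the number $T$ of rounds: for all $h\in[H]$, $1\le t\le T$ and $\pi,\pi^{(1)},\dots,\pi^{(t)}\in\Pi$, $$\frac{d^\pi_h}{d^{\pi^{(1:t)}}_h}\in\mathcal W_h,\qquad\text{where } d_h^{\pi^{(1:t)}}=\frac1t\sum_{i=1}^t d_h^{\pi^{(i)}} .$$ **Theorem.**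 There are universal constants $c>0$ and $k\in\mathbb N$ such that in every such setting GLOW with $K=1$ and $\gamma=\sqrt{C_{\mathsf{cov}}/(TL)}$ satisfies the following. 1. (Sample complexity.) Let $\epsilon>0$. For every integer $T\ge1$ with $$T\ \ge\ c\cdot\frac{H^2C_{\mathsf{cov}}}{\epsilon^2}\,L\cdot\log^k\!\Big(e+\frac{HC_{\mathsf{cov}}L}{\epsilon}\Big)$$ for which (ii) holds, with probability at least $1-\delta$ over the $T\cdot K=T$ collected trajectories, the output $\widehat\pi$ is $\epsilon$-suboptimal, i.e. $\mathbf{Risk}\le\epsilon$. In particular (taking the least such $T$), $N=\widetilde O\big(\frac{H^2C_{\mathsf{cov}}}{\epsilon^2}\log(|\mathcal F||\mathcal W|/\delta)\big)$ trajectories suffice. 2. (Regret.) For every integer $T\ge1$ for which (ii) holds, with probability at least $1-\delta$, $$\mathbf{Reg}=\sum_{t=1}^T\big(J(\pi^\star)-J(\pi^{(t)})\big)\ \le\ c\,\log^k(e+HT)\cdot H\sqrt{C_{\mathsf{cov}}\,T\,\log(|\mathcal F||\mathcal W|/\delta)} .$$ -/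

import Mathlib

open MeasureTheory
open scoped ENNReal

noncomputable section

namespace GLOW

/-- An episodic MDP with horizon `H` over states `X` and actions `A`. Layers `1, …, H` are
indexed by `Fin H`. The state following the last layer is a terminal state, so the last
transition kernel `P (H - 1)` has no influence on anything. -/
structure MDP (X A : Type*) (H : ℕ) where
  /-- transition probabilities -/
  P : Fin H → X → A → PMF X
  /-- reward distributions, supported in `[0, 1]` -/
  R : Fin H → X → A → Measure ℝ
  /-- initial state distribution -/
  d₁ : PMF X
  isProbabilityMeasure_R : ∀ h x a, IsProbabilityMeasure (R h x a)
  R_mem_Icc : ∀ h x a, ∀ᵐ r ∂(R h x a), r ∈ Set.Icc (0 : ℝ) 1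

/-- Randomized (Markov, time-dependent) policies. -/
abbrev Policy (X A : Type*) (H : ℕ) := Fin H → X → PMF A

/-- Deterministic policies. -/
abbrev DetPolicy (X A : Type*) (H : ℕ) := Fin H → X → A

/-- A deterministic policy, seen as a randomized one. -/
def DetPolicy.toPolicy {X A : Type*} {H : ℕ} (π : DetPolicy X A H) : Policy X A H :=
  fun h x => PMF.pure (π h x)

/-- Candidate value functions `f = (f_1, …, f_H)`. -/
abbrev ValueFn (X A : Type*) (H : ℕ) := Fin H → X → A → ℝ

/-- Weight functions `w = (w_1, …, w_H)`; the value `∞` is allowed. -/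
abbrev WeightFn (X A : Type*) (H : ℕ) := Fin H → X → A → ℝ≥0∞

/-- Trajectories `(x_1, a_1, r_1), …, (x_H, a_H, r_H)`. -/
abbrev Traj (X A : Type*) (H : ℕ) := Fin H → X × A × ℝ

/-- The part of a layer-indexed family that starts at layer `h`. -/
def fromLayer {H : ℕ} {β : Type*} (h : Fin H) (g : Fin H → β) : Fin (H - h) → β :=
  fun i => g ⟨h + i, by omega⟩

/-- Quotient of densities with the conventions `p / 0 = ∞` for `p > 0` and `0 / 0 = 1`. -/
def densityRatio (p q : ℝ≥0∞) : ℝ≥0∞ :=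
  open Classical in if p = 0 ∧ q = 0 then 1 else p / q

/-- The clipped weight `min {w, γ}`, for `γ ≥ 0`. -/
def clip (w : ℝ≥0∞) (γ : ℝ) : ℝ := (min w (ENNReal.ofReal γ)).toReal

section Rollout

variable {X A : Type*} [MeasurableSpace X] [MeasurableSpace A]

/-- Law of `n` consecutive steps started at a given state `x`: draw `a ∼ π_1(x)`, then
`r ∼ R_1(x, a)` and `x' ∼ P_1(x, a)`, and continue from `x'` with the remaining layers. -/
def rolloutLaw : (n : ℕ) → (Fin n → X → A → Measure ℝ) → (Fin n → X → A → PMF X) →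
    (Fin n → X → PMF A) → X → Measure (Fin n → X × A × ℝ)
  | 0, _, _, _, _ => Measure.dirac Fin.elim0
  | n + 1, R, P, π, x =>
      (π 0 x).toMeasure.bind fun a =>
        ((R 0 x a).prod ((P 0 x a).toMeasure.bind
            (rolloutLaw n (Fin.tail R) (Fin.tail P) (Fin.tail π)))).map
          fun p => Fin.cons (x, a, p.1) p.2

namespace MDP

variable {H : ℕ} (M : MDP X A H)

/-- The law `ℙ^π` of a trajectory generated by the policy `π`. -/
def trajLaw (π : Policy X A H) : Measure (Traj X A H) :=
  M.d₁.toMeasure.bind (rolloutLaw H M.R M.P π)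

/-- `J(π) = 𝔼^π[∑_h r_h]`. -/
def J (π : Policy X A H) : ℝ := ∫ τ, ∑ h, (τ h).2.2 ∂(M.trajLaw π)

/-- `V_h^π(x) = 𝔼^π[∑_{h' ≥ h} r_{h'} ∣ x_h = x]`. -/
def V (π : Policy X A H) (h : Fin H) (x : X) : ℝ :=
  ∫ τ, ∑ i, (τ i).2.2
    ∂(rolloutLaw (H - h) (fromLayer h M.R) (fromLayer h M.P) (fromLayer h π) x)

/-- `Q_h^π(x, a) = 𝔼^π[∑_{h' ≥ h} r_{h'} ∣ x_h = x, a_h = a]`: the action `a` is played at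
layer `h`, and `π` is followed from layer `h + 1` on. -/
def Q (π : Policy X A H) : ValueFn X A H :=
  fun h x a => M.V (Function.update π h fun _ => PMF.pure a) h x

/-- `π` maximizes the value function at all layers and states, among all policies. -/
def IsOptimal (π : Policy X A H) : Prop := ∀ π' h x, M.V π' h x ≤ M.V π h x

/-- The cumulative reward lies in `[0, 1]` almost surely, for all policies. -/
def RewardsNormalized : Prop :=
  ∀ π, ∀ᵐ τ ∂(M.trajLaw π), ∑ h, (τ h).2.2 ∈ Set.Icc (0 : ℝ) 1

/-- The occupancy measure `d_h^π(x, a) = ℙ^π[x_h = x, a_h = a]`. -/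
def occ (π : Policy X A H) (h : Fin H) (x : X) (a : A) : ℝ≥0∞ :=
  M.trajLaw π {τ | (τ h).1 = x ∧ (τ h).2.1 = a}

/-- The mixture occupancy `d_h^{π^{(1:t)}} = (1 / t) ∑_i d_h^{π^{(i)}}`. -/
def mixOcc {t : ℕ} (π : Fin t → Policy X A H) (h : Fin H) (x : X) (a : A) : ℝ≥0∞ :=
  (∑ i, M.occ (π i) h x a) / t

end MDP

end Rollout

section Classes

variable {X A : Type*} {H : ℕ}

/-- `π f` is a greedy policy of `f`, for every `f ∈ F`; ties are broken in an arbitrary way. -/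
def IsGreedy (F : Finset (ValueFn X A H)) (π : ValueFn X A H → DetPolicy X A H) : Prop :=
  ∀ f ∈ F, ∀ h x a, f h x a ≤ f h x (π f h x)

variable [MeasurableSpace X] [MeasurableSpace A] (M : MDP X A H)

/-- The coverability coefficient of the policy class `Π = {π_f : f ∈ F}`. -/
def MDP.coverability (F : Finset (ValueFn X A H)) (π : ValueFn X A H → DetPolicy X A H) :
    ℝ≥0∞ :=
  ⨅ μ : Fin H → PMF (X × A), ⨆ f ∈ F, ⨆ (h : Fin H) (x : X) (a : A),
    densityRatio (M.occ (π f).toPolicy h x a) (μ h (x, a))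

/-- Density ratio realizability, mixture version, up to time `T`: all the ratios
`d_h^π / d_h^{π^{(1:t)}}` with `1 ≤ t ≤ T` and `π, π^{(1)}, …, π^{(t)} ∈ Π` belong to
`W_h = {w_h : w ∈ W}`. -/
def MDP.MixtureRealizable (F : Finset (ValueFn X A H)) (W : Finset (WeightFn X A H))
    (π : ValueFn X A H → DetPolicy X A H) (T : ℕ) : Prop :=
  ∀ (h : Fin H), ∀ f ∈ F, ∀ t : ℕ, 1 ≤ t → t ≤ T → ∀ g : Fin t → ValueFn X A H,
    (∀ i, g i ∈ F) → ∃ w ∈ W, ∀ x a,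
      w h x a = densityRatio (M.occ (π f).toPolicy h x a)
        (M.mixOcc (fun i => (π (g i)).toPolicy) h x a)

end Classes

section Algorithm

variable {X A : Type*} {H : ℕ}

/-- The data collected in `n` rounds, with `K` trajectories per round. -/
abbrev Data (X A : Type*) (H K n : ℕ) := Fin n → Fin K → Traj X A H

/-- The empirical average of `g` over the data (`0` if there are no data). -/
def empMean {K n : ℕ} (D : Data X A H K n) (g : Traj X A H → ℝ) : ℝ :=
  (∑ i, ∑ j, g (D i j)) / ((K : ℝ) * n)

/-- The empirical Bellman residual `f_h(x_h, a_h) - r_h - max_{a'} f_{h+1}(x_{h+1}, a')`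
along a trajectory, where `f_{H+1} = 0`. -/
def residual (f : ValueFn X A H) (h : Fin H) (τ : Traj X A H) : ℝ :=
  f h (τ h).1 (τ h).2.1 - (τ h).2.2 -
    if hh : (h : ℕ) + 1 < H then ⨆ a', f ⟨h + 1, hh⟩ (τ ⟨h + 1, hh⟩).1 a' else 0

/-- The inputs of the algorithm besides the two classes: number of rounds `T`, batch size `K`,
clipping scale `γ`, and confidence parameter `δ`. -/
structure Params where
  T : ℕ
  K : ℕ
  γ : ℝ
  δ : ℝ

variable (p : Params) (F : Finset (ValueFn X A H)) (W : Finset (WeightFn X A H))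

/-- The clipping level `γ^{(t)} = γ t` in round `t = n + 1`, that is, after `n` rounds. -/
def Params.clipLevel (n : ℕ) : ℝ := p.γ * (n + 1)

/-- `α^{(t)} = 8 / γ^{(t)}` in round `t = n + 1`. -/
def Params.α (n : ℕ) : ℝ := 8 / p.clipLevel n

/-- `β^{(t)} = 36 γ^{(t)} / (K (t - 1)) · log (6 |F| |W| T H / δ)` in round `t = n + 1`. -/
def Params.β (n : ℕ) : ℝ :=
  36 * p.clipLevel n / (p.K * n) *
    Real.log (6 * (F.card : ℝ) * (W.card : ℝ) * p.T * H / p.δ)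

/-- The confidence set `F^{(t)}` in round `t = n + 1`, given the data of the first `n` rounds. -/
def confidenceSet {n : ℕ} (D : Data X A H p.K n) : Set (ValueFn X A H) :=
  {f | f ∈ F ∧ ∀ h : Fin H, ∀ w ∈ W,
    empMean D (fun τ =>
      residual f h τ * clip (w h (τ h).1 (τ h).2.1) (p.clipLevel n) -
        p.α n * clip (w h (τ h).1 (τ h).2.1) (p.clipLevel n) ^ 2) ≤ p.β F W n}

/-- Without data there is no constraint: `F^{(1)} = F`. -/
theorem confidenceSet_zero (D : Data X A H p.K 0) : confidenceSet p F W D = ↑F := by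
  ext f
  simp [confidenceSet, empMean, Params.β]

/-- The empirical optimistic value `𝔼̂[f_1(x_1, π_f(x_1))]`. -/
def optimisticValue [NeZero H] (π : ValueFn X A H → DetPolicy X A H) {K n : ℕ}
    (D : Data X A H K n) (f : ValueFn X A H) : ℝ :=
  empMean D fun τ => f 0 (τ 0).1 (π f 0 (τ 0).1)

variable [MeasurableSpace X] [MeasurableSpace A]

/-- `rule` is a version of the algorithm: in round `t = n + 1` it selects, as a measurable
function of the data of the first `n` rounds, a maximizer `f^{(t)}` of the optimistic value over
the confidence set. Ties are broken arbitrarily, and an arbitrary element of `F` is selected in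
case that the confidence set is empty. -/
structure IsGlowRule [NeZero H] (π : ValueFn X A H → DetPolicy X A H)
    (rule : (n : ℕ) → Data X A H p.K n → ValueFn X A H) : Prop where
  mem : ∀ n D, rule n D ∈ F
  mem_confidenceSet : ∀ n (D : Data X A H p.K n),
    (confidenceSet p F W D).Nonempty → rule n D ∈ confidenceSet p F W D
  le_optimisticValue : ∀ n (D : Data X A H p.K n), ∀ g ∈ confidenceSet p F W D,
    optimisticValue π D g ≤ optimisticValue π D (rule n D)
  measurableSet : ∀ n f, MeasurableSet {D | rule n D = f}

/-- Law of the data when, in every round, `K` independent trajectories of the greedy policy of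
the selected value function are collected. -/
def runLaw (M : MDP X A H) (π : ValueFn X A H → DetPolicy X A H) {K : ℕ}
    (rule : (n : ℕ) → Data X A H K n → ValueFn X A H) : (n : ℕ) → Measure (Data X A H K n)
  | 0 => Measure.dirac Fin.elim0
  | n + 1 => (runLaw M π rule n).bind fun D =>
      (Measure.pi fun _ : Fin K => M.trajLaw (π (rule n D)).toPolicy).map
        fun b => Fin.snoc (α := fun _ => Fin K → Traj X A H) D b

/-- The policy `π^{(t)}` executed in round `t` of a run; it depends on the data of the earlier
rounds only. -/
def playedPolicy (π : ValueFn X A H → DetPolicy X A H) {K T : ℕ}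
    (rule : (n : ℕ) → Data X A H K n → ValueFn X A H) (D : Data X A H K T) (t : Fin T) :
    Policy X A H :=
  (π (rule t fun i => D (Fin.castLE t.isLt.le i))).toPolicy

/-- The regret `∑_t (J(π⋆) - J(π^{(t)}))`. -/
def MDP.regret (M : MDP X A H) (πstar : Policy X A H) {T : ℕ} (π : Fin T → Policy X A H) : ℝ :=
  ∑ t, (M.J πstar - M.J (π t))

/-- `Risk = 𝔼_{i ∼ p}[J(π⋆) - J(π_i)]`, for a policy `π_i` drawn at random through its index. -/
def MDP.risk (M : MDP X A H) (πstar : Policy X A H) {ι : Type*} (p : PMF ι)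
    (π : ι → Policy X A H) : ℝ :=
  ∑' i, (p i).toReal * (M.J πstar - M.J (π i))

end Algorithm

end GLOW

end

/-!
The proof is an optimism argument with clipped importance weights.

Conditionally on `(x_h, a_h)`, the residual of a candidate `f` is centred at its Bellman error
(`integral_residual_mul`), and the Bellman error of `Q⋆` vanishes (`bellmanError_Q`). The data are
adaptive, so empirical averages are controlled by exponential supermartingales
(`lintegral_prod_runLaw_le_one`, `runLaw_sum_ge_le`): the clipped weights bound the residuals of
`Q⋆` conditionally on state and action (`lintegral_exp_residual_le_one`), and everything else is
handled by a Bernstein-type bound with second moments (`lintegral_exp_bernstein`). A union bound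
over the rounds, the layers, the weights and the candidates shows that, with probability `1 - δ`,
no deviation occurs (`le_runLaw_no_deviation`).

On this event `Q⋆` lies in every confidence set, so the selected `f` predicts, up to the error of
the empirical initial values, at least the optimal value. The predicted value exceeds the true
value of the greedy policy by the sum of its Bellman errors (`predictedValue_sub_J`). By
realizability, the ratio of the occupancy `d` of this policy and of the mixture of the earlier ones
is one of the weights. Clipping this ratio at `γ t` transfers the constraint of the confidence set
to `d`; both the part of `d` that is lost by clipping and the second moment of the clipped weight
are bounded by `∑ d min (1, d / (γ S))`, where `S` is the sum of the earlier occupancies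
(`clipped_ratio_bounds`, `integral_bellmanError_le`). If all occupancies are at most `2 C μ`, then
these potentials add up to `O (C + C γ⁻¹ log T)` over all rounds (`sum_potential_le`): as long as
`S` is below `2 C μ`, the mass `d` is charged to the growth of `S`, and later the sum of the
`d / S` telescopes logarithmically.

Altogether the regret is at most
`1 + T l + l⁻¹ s log T + H T γ s + H C (1 + γ⁻¹ log T)` up to constants, where `s` is the
logarithm in the definition of `β` and `l` a free parameter. The choice `l = √(L / T)` and
`γ = √(C / (T L))` yields the regret bound (`regret_bound_arith`). This needs `C ≤ T L`, `L ≤ T`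
and a lower bound for `L`. If one of the first two fails, then the trivial bound `T` suffices; the
last one holds unless `|F| = 1`, in which case only optimal policies are played. The sample
complexity bound follows from the regret bound, since the risk is the regret divided by `T`.
-/

set_option linter.unusedSectionVars false

namespace GLOW

/-! ### Laws of trajectories -/

section TrajectoryLaws

variable {X A : Type*} [MeasurableSpace X] [MeasurableSpace A]

theorem measurable_finCons {n : ℕ} (x : X) (a : A) :
    Measurable fun p : ℝ × (Fin n → X × A × ℝ) =>
      (Fin.cons (x, a, p.1) p.2 : Fin (n + 1) → X × A × ℝ) := by
  refine measurable_pi_iff.2 fun i => ?_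
  refine Fin.cases ?_ (fun j => ?_) i
  · simp only [Fin.cons_zero]; fun_prop
  · simp only [Fin.cons_succ]; fun_prop

variable [Countable X] [DiscreteMeasurableSpace X] [Countable A] [DiscreteMeasurableSpace A]

theorem isProbabilityMeasure_rolloutLaw : ∀ (n : ℕ) (R : Fin n → X → A → Measure ℝ)
    (_ : ∀ i x a, IsProbabilityMeasure (R i x a)) (P : Fin n → X → A → PMF X)
    (π : Fin n → X → PMF A) (x : X), IsProbabilityMeasure (rolloutLaw n R P π x)
  | 0, _, _, _, _, _ => by unfold rolloutLaw; infer_instance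
  | n + 1, R, hR, P, π, x => by
    have := hR
    have ih := isProbabilityMeasure_rolloutLaw n (Fin.tail R) (fun i => hR i.succ)
      (Fin.tail P) (Fin.tail π)
    unfold rolloutLaw
    refine isProbabilityMeasure_bind (Measurable.of_discrete).aemeasurable (ae_of_all _ fun a => ?_)
    have : IsProbabilityMeasure ((P 0 x a).toMeasure.bind
            (rolloutLaw n (Fin.tail R) (Fin.tail P) (Fin.tail π))) :=
      isProbabilityMeasure_bind (Measurable.of_discrete).aemeasurable (ae_of_all _ ih)
    exact Measure.isProbabilityMeasure_map (measurable_finCons x a).aemeasurable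

/-- Expectations under a rollout, unfolded over its first step. -/
theorem lintegral_rolloutLaw_succ {n : ℕ} (R : Fin (n + 1) → X → A → Measure ℝ)
    (hR : ∀ i x a, IsProbabilityMeasure (R i x a)) (P : Fin (n + 1) → X → A → PMF X)
    (π : Fin (n + 1) → X → PMF A) (x : X) {G : (Fin (n + 1) → X × A × ℝ) → ℝ≥0∞}
    (hG : Measurable G) :
    ∫⁻ τ, G τ ∂rolloutLaw (n + 1) R P π x =
      ∫⁻ a, ∫⁻ r, ∫⁻ x', ∫⁻ τ, G (Fin.cons (x, a, r) τ)
        ∂rolloutLaw n (Fin.tail R) (Fin.tail P) (Fin.tail π) x'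
        ∂(P 0 x a).toMeasure ∂(R 0 x a) ∂(π 0 x).toMeasure := by
  have ih := isProbabilityMeasure_rolloutLaw n (Fin.tail R) (fun i => hR i.succ)
    (Fin.tail P) (Fin.tail π)
  rw [rolloutLaw, Measure.lintegral_bind (Measurable.of_discrete).aemeasurable hG.aemeasurable]
  refine lintegral_congr fun a => ?_
  have : IsProbabilityMeasure ((P 0 x a).toMeasure.bind
      (rolloutLaw n (Fin.tail R) (Fin.tail P) (Fin.tail π))) :=
    isProbabilityMeasure_bind (Measurable.of_discrete).aemeasurable (ae_of_all _ ih)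
  have hG' := hG.comp (measurable_finCons (n := n) x a)
  rw [lintegral_map hG (measurable_finCons x a), lintegral_prod
    (fun p : ℝ × (Fin n → X × A × ℝ) => G (Fin.cons (x, a, p.1) p.2)) hG'.aemeasurable]
  refine lintegral_congr fun r => ?_
  rw [Measure.lintegral_bind (Measurable.of_discrete).aemeasurable]
  exact (hG'.comp measurable_prodMk_left).aemeasurable

theorem lintegral_rolloutLaw_first {n : ℕ} (R : Fin (n + 1) → X → A → Measure ℝ)
    (hR : ∀ i x a, IsProbabilityMeasure (R i x a)) (P : Fin (n + 1) → X → A → PMF X)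
    (π : Fin (n + 1) → X → PMF A) (x : X) (g : X → ℝ≥0∞) :
    ∫⁻ τ, g (τ 0).1 ∂rolloutLaw (n + 1) R P π x = g x := by
  have := hR
  have ih := isProbabilityMeasure_rolloutLaw n (Fin.tail R) (fun i => hR i.succ)
    (Fin.tail P) (Fin.tail π)
  rw [lintegral_rolloutLaw_succ R hR P π x (G := fun τ => g (τ 0).1)
    ((Measurable.of_discrete (f := g)).comp (by fun_prop))]
  simp

/-- The value `v (x_{h+1})` of the state following layer `h`, and `0` for the terminal state. -/
noncomputable def nextVal {n : ℕ} (v : X → ℝ) (h : Fin n) (τ : Fin n → X × A × ℝ) : ℝ :=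
  if hh : (h : ℕ) + 1 < n then v (τ ⟨h + 1, hh⟩).1 else 0

theorem measurable_nextVal {n : ℕ} (v : X → ℝ) (h : Fin n) :
    Measurable (nextVal (A := A) v h) := by
  unfold nextVal
  split_ifs
  · exact (Measurable.of_discrete (f := v)).comp (by fun_prop)
  · exact measurable_const

theorem abs_nextVal_le {n : ℕ} {v : X → ℝ} {B : ℝ} (hv : ∀ x, |v x| ≤ B) (h : Fin n)
    (τ : Fin n → X × A × ℝ) : |nextVal v h τ| ≤ B := by
  unfold nextVal
  split_ifs
  · exact hv _
  · simpa using (abs_nonneg _).trans (hv (τ h).1)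

/-- The law of `r + v x'` for an independent reward `r` and next state `x'`. -/
noncomputable def targetLaw (ρ : Measure ℝ) (p : PMF X) (v : X → ℝ) : Measure ℝ :=
  (ρ.prod p.toMeasure).map fun q => q.1 + v q.2

theorem measurable_target (v : X → ℝ) : Measurable fun q : ℝ × X => q.1 + v q.2 :=
  measurable_fst.add ((Measurable.of_discrete (f := v)).comp measurable_snd)

theorem lintegral_targetLaw (ρ : Measure ℝ) (p : PMF X) (v : X → ℝ) {G : ℝ → ℝ≥0∞}
    (hG : Measurable G) :
    ∫⁻ y, G y ∂targetLaw ρ p v = ∫⁻ r, ∫⁻ x', G (r + v x') ∂p.toMeasure ∂ρ := by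
  rw [targetLaw, lintegral_map hG (measurable_target v),
    lintegral_prod (fun q : ℝ × X => G (q.1 + v q.2))
      (hG.comp (measurable_target v)).aemeasurable]

/-- Given the state and the action in layer `h`, the sum of the reward and of the value of the
next state follows `targetLaw`. In the last layer, `v` has to vanish. -/
theorem lintegral_rolloutLaw_target : ∀ (n : ℕ) (R : Fin n → X → A → Measure ℝ)
    (_ : ∀ i x a, IsProbabilityMeasure (R i x a)) (P : Fin n → X → A → PMF X)
    (π : Fin n → X → PMF A) (x : X) (h : Fin n) (v : X → ℝ)
    (_ : ¬ (h : ℕ) + 1 < n → v = 0) (G : (X × A) × ℝ → ℝ≥0∞) (_ : Measurable G),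
    ∫⁻ τ, G (((τ h).1, (τ h).2.1), (τ h).2.2 + nextVal v h τ) ∂rolloutLaw n R P π x =
      ∫⁻ τ, ∫⁻ y, G (((τ h).1, (τ h).2.1), y)
        ∂targetLaw (R h (τ h).1 (τ h).2.1) (P h (τ h).1 (τ h).2.1) v ∂rolloutLaw n R P π x
  | 0, _, _, _, _, _, h, _, _, _, _ => h.elim0
  | n + 1, R, hR, P, π, x, h, v, hv, G, hG => by
    have ih := isProbabilityMeasure_rolloutLaw n (Fin.tail R) (fun i => hR i.succ)
      (Fin.tail P) (Fin.tail π)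
    have hm1 : Measurable fun τ : Fin (n + 1) → X × A × ℝ =>
        G (((τ h).1, (τ h).2.1), (τ h).2.2 + nextVal v h τ) := by
      have := measurable_nextVal (A := A) v h
      exact hG.comp (by fun_prop)
    have hm2 : Measurable fun τ : Fin (n + 1) → X × A × ℝ =>
        ∫⁻ y, G (((τ h).1, (τ h).2.1), y)
          ∂targetLaw (R h (τ h).1 (τ h).2.1) (P h (τ h).1 (τ h).2.1) v :=
      (Measurable.of_discrete (f := fun p : X × A =>
        ∫⁻ y, G (p, y) ∂targetLaw (R h p.1 p.2) (P h p.1 p.2) v)).comp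
          (g := fun p : X × A => _) (f := fun τ : Fin (n + 1) → X × A × ℝ =>
            ((τ h).1, (τ h).2.1)) (by fun_prop)
    rw [lintegral_rolloutLaw_succ R hR P π x hm1, lintegral_rolloutLaw_succ R hR P π x hm2]
    refine lintegral_congr fun a => ?_
    induction h using Fin.cases with
    | zero =>
      have := hR
      have hGa : Measurable fun y => G ((x, a), y) := hG.comp measurable_prodMk_left
      simp only [Fin.cons_zero, lintegral_const, measure_univ, mul_one]
      rw [lintegral_targetLaw _ _ _ hGa]
      refine lintegral_congr fun r => lintegral_congr fun x' => ?_
      cases n with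
      | zero =>
        have : v = 0 := hv (by simp)
        simp [nextVal, this]
      | succ m =>
        have hnext : ∀ τ : Fin (m + 1) → X × A × ℝ, G ((x, a), r + nextVal v 0
            (Fin.cons (x, a, r) τ : Fin (m + 2) → X × A × ℝ)) =
            G ((x, a), r + v (τ 0).1) := fun τ => rfl
        simp only [hnext]
        exact lintegral_rolloutLaw_first _ (fun i => hR i.succ) _ _ x'
          fun y => G ((x, a), r + v y)
    | succ j =>
      refine lintegral_congr fun r => lintegral_congr fun x' => ?_
      have key := lintegral_rolloutLaw_target n (Fin.tail R) (fun i => hR i.succ) (Fin.tail P)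
        (Fin.tail π) x' j v (fun hj => hv (by simpa using hj)) G hG
      have hnext : ∀ (s : X × A × ℝ) (τ : Fin n → X × A × ℝ),
          nextVal v j.succ (Fin.cons s τ : Fin (n + 1) → X × A × ℝ) = nextVal v j τ := by
        intro s τ
        unfold nextVal
        by_cases hj : (j : ℕ) + 1 < n
        · rw [dif_pos hj, dif_pos (by simpa using hj)]
          rfl
        · rw [dif_neg hj, dif_neg (by simpa using hj)]
      simp only [Fin.cons_succ, hnext]
      exact key

/-- A property of single steps that holds almost surely in each step holds almost surely along
the whole trajectory. -/
theorem ae_rolloutLaw : ∀ (n : ℕ) (R : Fin n → X → A → Measure ℝ)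
    (_ : ∀ i x a, IsProbabilityMeasure (R i x a)) (P : Fin n → X → A → PMF X)
    (π : Fin n → X → PMF A) (x : X) (p : Fin n → X × A × ℝ → Prop)
    (_ : ∀ i, MeasurableSet {s | p i s})
    (_ : ∀ i x, ∀ᵐ a ∂(π i x).toMeasure, ∀ᵐ r ∂(R i x a), p i (x, a, r)),
    ∀ᵐ τ ∂rolloutLaw n R P π x, ∀ i, p i (τ i)
  | 0, _, _, _, _, _, _, _, _ => ae_of_all _ fun _ i => i.elim0
  | n + 1, R, hR, P, π, x, p, hp, h => by
    have ih := fun x' => ae_rolloutLaw n (Fin.tail R) (fun i => hR i.succ)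
      (Fin.tail P) (Fin.tail π) x' (fun i => p i.succ) (fun i => hp i.succ) (fun i => h i.succ)
    have hS : MeasurableSet {τ : Fin (n + 1) → X × A × ℝ | ∀ i, p i (τ i)} := by
      simp only [Set.ofPred_forall]
      exact MeasurableSet.iInter fun i => measurable_pi_apply i (hp i)
    rw [ae_iff, ← lintegral_indicator_one (by exact hS.compl),
      lintegral_rolloutLaw_succ R hR P π x (measurable_one.indicator (by exact hS.compl))]
    refine lintegral_eq_zero_of_ae_eq_zero ?_
    filter_upwards [h 0 x] with a ha
    refine lintegral_eq_zero_of_ae_eq_zero ?_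
    filter_upwards [ha] with r hr
    refine lintegral_eq_zero_of_ae_eq_zero (ae_of_all _ fun x' => ?_)
    refine lintegral_eq_zero_of_ae_eq_zero ?_
    filter_upwards [ih x'] with τ hτ
    refine Set.indicator_of_notMem ?_ _
    simp only [Set.mem_ofPred_eq, not_not]
    exact Fin.cases hr hτ

theorem integrable_of_forall_bound {α : Type*} [MeasurableSpace α] [Countable α]
    [DiscreteMeasurableSpace α] (μ : Measure α) [IsFiniteMeasure μ] {v : α → ℝ} {B : ℝ}
    (hv : ∀ x, |v x| ≤ B) : Integrable v μ :=
  Integrable.of_bound (Measurable.of_discrete (f := v)).aestronglyMeasurable B (ae_of_all _ hv)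

namespace MDP

variable {H : ℕ} (M : MDP X A H) (π : Policy X A H)

instance : IsProbabilityMeasure (M.trajLaw π) :=
  isProbabilityMeasure_bind (Measurable.of_discrete).aemeasurable
    (ae_of_all _ (isProbabilityMeasure_rolloutLaw H M.R M.isProbabilityMeasure_R M.P π))

theorem lintegral_trajLaw {G : Traj X A H → ℝ≥0∞} (hG : Measurable G) :
    ∫⁻ τ, G τ ∂M.trajLaw π =
      ∫⁻ x, ∫⁻ τ, G τ ∂rolloutLaw H M.R M.P π x ∂M.d₁.toMeasure := by
  rw [trajLaw, Measure.lintegral_bind (Measurable.of_discrete).aemeasurable hG.aemeasurable]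

theorem ae_trajLaw (p : Fin H → X × A × ℝ → Prop) (hp : ∀ i, MeasurableSet {s | p i s})
    (h : ∀ i x, ∀ᵐ a ∂(π i x).toMeasure, ∀ᵐ r ∂(M.R i x a), p i (x, a, r)) :
    ∀ᵐ τ ∂M.trajLaw π, ∀ i, p i (τ i) := by
  have hS : MeasurableSet {τ : Traj X A H | ∀ i, p i (τ i)} := by
    simp only [Set.ofPred_forall]
    exact MeasurableSet.iInter fun i => measurable_pi_apply i (hp i)
  rw [ae_iff, ← lintegral_indicator_one (by exact hS.compl),
    lintegral_trajLaw M π (measurable_one.indicator (by exact hS.compl))]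
  refine lintegral_eq_zero_of_ae_eq_zero (ae_of_all _ fun x => ?_)
  refine lintegral_eq_zero_of_ae_eq_zero ?_
  filter_upwards [ae_rolloutLaw H M.R M.isProbabilityMeasure_R M.P π x p hp h] with τ hτ
  refine Set.indicator_of_notMem ?_ _
  simpa using hτ

theorem ae_reward_mem :
    ∀ᵐ τ ∂M.trajLaw π, ∀ i, (τ i).2.2 ∈ Set.Icc (0 : ℝ) 1 :=
  M.ae_trajLaw π (fun _ s => s.2.2 ∈ Set.Icc (0 : ℝ) 1)
    (fun _ => (measurable_snd.comp measurable_snd) measurableSet_Icc)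
    fun i x => ae_of_all _ fun a => M.R_mem_Icc i x a

theorem ae_action_eq (d : DetPolicy X A H) :
    ∀ᵐ τ ∂M.trajLaw d.toPolicy, ∀ i, (τ i).2.1 = d i (τ i).1 := by
  refine M.ae_trajLaw d.toPolicy (fun i s => s.2.1 = d i s.1) (fun i => ?_) fun i x => ?_
  · exact measurableSet_eq_fun (by fun_prop)
      ((Measurable.of_discrete (f := d i)).comp (by fun_prop))
  · simp [DetPolicy.toPolicy, PMF.toMeasure_pure, ae_dirac_eq]

theorem lintegral_trajLaw_first [NeZero H] (g : X → ℝ≥0∞) :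
    ∫⁻ τ, g (τ 0).1 ∂M.trajLaw π = ∫⁻ x, g x ∂M.d₁.toMeasure := by
  rw [lintegral_trajLaw M π (G := fun τ => g (τ 0).1)
    ((Measurable.of_discrete (f := g)).comp (by fun_prop))]
  refine lintegral_congr fun x => ?_
  obtain ⟨n, rfl⟩ : ∃ n, H = n + 1 := ⟨H - 1, by have := NeZero.pos H; omega⟩
  exact lintegral_rolloutLaw_first M.R M.isProbabilityMeasure_R M.P π x g

/-- Whatever the policy, the initial state is distributed according to `d₁`. -/
theorem map_trajLaw_first [NeZero H] :
    (M.trajLaw π).map (fun τ => (τ 0).1) = M.d₁.toMeasure := by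
  refine Measure.ext_of_lintegral _ fun g hg => ?_
  rw [lintegral_map hg (by fun_prop)]
  exact M.lintegral_trajLaw_first π g

/-- The occupancy measure of layer `h`, as a measure on state-action pairs. -/
noncomputable def occMeasure (h : Fin H) : Measure (X × A) :=
  (M.trajLaw π).map fun τ => ((τ h).1, (τ h).2.1)

instance (h : Fin H) : IsProbabilityMeasure (M.occMeasure π h) :=
  Measure.isProbabilityMeasure_map (by fun_prop)

theorem occMeasure_singleton (h : Fin H) (p : X × A) :
    M.occMeasure π h {p} = M.occ π h p.1 p.2 := by
  rw [occMeasure, Measure.map_apply (by fun_prop) (measurableSet_singleton p), occ]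
  congr 1
  ext τ
  simp [Prod.ext_iff]

/-- The conditional law of `r_h + v (x_{h+1})` given the state and the action in layer `h`. -/
noncomputable def targetKernel (h : Fin H) (v : X → ℝ) : ProbabilityTheory.Kernel (X × A) ℝ :=
  ProbabilityTheory.Kernel.ofFunOfCountable
    fun p => targetLaw (M.R h p.1 p.2) (M.P h p.1 p.2) v

instance (h : Fin H) (v : X → ℝ) : ProbabilityTheory.IsMarkovKernel (M.targetKernel h v) := by
  refine ⟨fun p => ?_⟩
  have := M.isProbabilityMeasure_R
  exact Measure.isProbabilityMeasure_map (measurable_target v).aemeasurable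

theorem map_trajLaw_target (h : Fin H) (v : X → ℝ) (hv : ¬ (h : ℕ) + 1 < H → v = 0) :
    (M.trajLaw π).map (fun τ => (((τ h).1, (τ h).2.1), (τ h).2.2 + nextVal v h τ)) =
      (M.occMeasure π h).compProd (M.targetKernel h v) := by
  have hm := measurable_nextVal (A := A) v h
  have hm1 : Measurable fun τ : Traj X A H =>
      (((τ h).1, (τ h).2.1), (τ h).2.2 + nextVal v h τ) := by fun_prop
  refine Measure.ext_of_lintegral _ fun G hG => ?_
  have hd : Measurable fun p : X × A => ∫⁻ y, G (p, y) ∂M.targetKernel h v p :=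
    Measurable.of_discrete
  have hd' : Measurable fun τ : Traj X A H =>
      ∫⁻ y, G (((τ h).1, (τ h).2.1), y) ∂M.targetKernel h v ((τ h).1, (τ h).2.1) :=
    hd.comp (f := fun τ : Traj X A H => ((τ h).1, (τ h).2.1)) (by fun_prop)
  rw [Measure.lintegral_compProd hG, lintegral_map hG hm1, occMeasure,
    lintegral_map hd (by fun_prop), lintegral_trajLaw M π
      (G := fun τ => G (((τ h).1, (τ h).2.1), (τ h).2.2 + nextVal v h τ))
      (hG.comp hm1),
    lintegral_trajLaw M π hd']
  exact lintegral_congr fun x =>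
    lintegral_rolloutLaw_target H M.R M.isProbabilityMeasure_R M.P π x h v hv G hG

/-- The backup `𝔼[r + v x']` of a function `v` of the next state. -/
noncomputable def backup (h : Fin H) (v : X → ℝ) (p : X × A) : ℝ :=
  ∫ r, r ∂M.R h p.1 p.2 + ∫ x', v x' ∂(M.P h p.1 p.2).toMeasure

theorem integrable_reward (h : Fin H) (x : X) (a : A) :
    Integrable (fun r => r) (M.R h x a) := by
  have := M.isProbabilityMeasure_R
  refine Integrable.of_bound (by fun_prop) 1 ?_
  filter_upwards [M.R_mem_Icc h x a] with r hr
  rw [Real.norm_eq_abs, abs_of_nonneg hr.1]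
  exact hr.2

theorem integral_targetKernel (h : Fin H) {v : X → ℝ} {B : ℝ} (hv : ∀ x, |v x| ≤ B)
    (p : X × A) : ∫ y, y ∂M.targetKernel h v p = M.backup h v p := by
  have := M.isProbabilityMeasure_R
  change ∫ y, y ∂targetLaw _ _ _ = _
  rw [targetLaw, integral_map (measurable_target v).aemeasurable (by fun_prop), backup]
  rw [integral_add ((M.integrable_reward h p.1 p.2).comp_fst _)
    ((integrable_of_forall_bound _ hv).comp_snd _), integral_fun_fst (fun r : ℝ => r),
    integral_fun_snd]
  simp

/-- Conditioning on the state and the action of layer `h`. -/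
theorem integral_target_mul (h : Fin H) {v : X → ℝ} {B : ℝ} (hv : ∀ x, |v x| ≤ B)
    (hv0 : ¬ (h : ℕ) + 1 < H → v = 0) {u : X × A → ℝ} {B' : ℝ} (hu : ∀ p, |u p| ≤ B') :
    ∫ τ, ((τ h).2.2 + nextVal v h τ) * u ((τ h).1, (τ h).2.1) ∂M.trajLaw π =
      ∫ p, M.backup h v p * u p ∂M.occMeasure π h := by
  have hm := measurable_nextVal (A := A) v h
  have hm1 : Measurable fun τ : Traj X A H =>
      (((τ h).1, (τ h).2.1), (τ h).2.2 + nextVal v h τ) := by fun_prop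
  have hum : Measurable fun q : (X × A) × ℝ => q.2 * u q.1 :=
    measurable_snd.mul ((Measurable.of_discrete (f := u)).comp measurable_fst)
  have h1 := integral_map (μ := M.trajLaw π) hm1.aemeasurable
    (f := fun q : (X × A) × ℝ => q.2 * u q.1) hum.aestronglyMeasurable
  rw [← h1, map_trajLaw_target M π h v hv0, Measure.integral_compProd]
  · refine integral_congr_ae (ae_of_all _ fun p => ?_)
    simp only [integral_mul_const, integral_targetKernel M h hv]
  · rw [← map_trajLaw_target M π h v hv0,
      integrable_map_measure hum.aestronglyMeasurable hm1.aemeasurable]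
    refine Integrable.of_bound (hum.comp hm1).aestronglyMeasurable ((1 + B) * B') ?_
    filter_upwards [M.ae_reward_mem π] with τ hτ
    rw [Function.comp_apply, Real.norm_eq_abs, abs_mul]
    have h2 := abs_nextVal_le hv h τ
    have h3 : |(τ h).2.2| ≤ 1 := by rw [abs_of_nonneg (hτ h).1]; exact (hτ h).2
    have h4 : |(τ h).2.2 + nextVal v h τ| ≤ 1 + B := (abs_add_le _ _).trans (add_le_add h3 h2)
    exact mul_le_mul h4 (hu _) (abs_nonneg _) ((abs_nonneg _).trans h4)

theorem integral_occMeasure (h : Fin H) {u : X × A → ℝ} {B : ℝ} (hu : ∀ p, |u p| ≤ B) :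
    ∫ p, u p ∂M.occMeasure π h = ∑' p : X × A, (M.occ π h p.1 p.2).toReal * u p := by
  rw [integral_countable (integrable_of_forall_bound _ hu)]
  refine tsum_congr fun p => ?_
  rw [measureReal_def, occMeasure_singleton, smul_eq_mul]

end MDP

end TrajectoryLaws

/-! ### Value functions and the Bellman equations -/

section Values

variable {X A : Type*}

/-- The state value `max_a f_k(x, a)`, with layers indexed by natural numbers and the value `0`
beyond the last layer. -/
noncomputable def stateValue {H : ℕ} (f : ValueFn X A H) (k : ℕ) (x : X) : ℝ :=
  if hk : k < H then ⨆ a, f ⟨k, hk⟩ x a else 0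

theorem residual_eq {H : ℕ} (f : ValueFn X A H) (h : Fin H) (τ : Traj X A H) :
    residual f h τ =
      f h (τ h).1 (τ h).2.1 - ((τ h).2.2 + nextVal (stateValue f (h + 1)) h τ) := by
  unfold residual nextVal stateValue
  split_ifs <;> ring

theorem stateValue_eq_zero {H : ℕ} (f : ValueFn X A H) (h : Fin H) (hh : ¬ (h : ℕ) + 1 < H) :
    stateValue f (h + 1) = 0 := by
  funext x
  simp [stateValue, hh]

theorem abs_stateValue_le {H : ℕ} {f : ValueFn X A H}
    (hf : ∀ h x a, f h x a ∈ Set.Icc (0 : ℝ) 1) (k : ℕ) (x : X) : |stateValue f k x| ≤ 1 := by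
  unfold stateValue
  split_ifs with hk
  · rw [abs_of_nonneg (Real.iSup_nonneg fun a => (hf _ x a).1)]
    exact Real.iSup_le (fun a => (hf _ x a).2) zero_le_one
  · simp

theorem stateValue_of_greedy {H : ℕ} {f : ValueFn X A H} {d : DetPolicy X A H}
    (hd : ∀ h x a, f h x a ≤ f h x (d h x)) (h : Fin H) (x : X) :
    stateValue f h x = f h x (d h x) := by
  have : Nonempty A := ⟨d h x⟩
  rw [stateValue, dif_pos h.2]
  exact le_antisymm (ciSup_le (hd h x)) (le_ciSup (f := fun a => f h x a)
    ⟨f h x (d h x), by rintro _ ⟨a, rfl⟩; exact hd h x a⟩ (d h x))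

variable [MeasurableSpace X] [MeasurableSpace A]

/-- The expected total reward of a rollout. -/
noncomputable def rolloutValue (n : ℕ) (R : Fin n → X → A → Measure ℝ) (P : Fin n → X → A → PMF X)
    (π : Fin n → X → PMF A) (x : X) : ℝ :=
  ∫ τ, ∑ i, (τ i).2.2 ∂rolloutLaw n R P π x

theorem rolloutValue_congr {n n' : ℕ} (e : n' = n) {R : Fin n → X → A → Measure ℝ}
    {P : Fin n → X → A → PMF X} {π : Fin n → X → PMF A} {R' : Fin n' → X → A → Measure ℝ}
    {P' : Fin n' → X → A → PMF X} {π' : Fin n' → X → PMF A}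
    (hR : ∀ i, R (Fin.cast e i) = R' i) (hP : ∀ i, P (Fin.cast e i) = P' i)
    (hπ : ∀ i, π (Fin.cast e i) = π' i) :
    rolloutValue n R P π = rolloutValue n' R' P' π' := by
  subst e
  obtain rfl : R = R' := funext hR
  obtain rfl : P = P' := funext hP
  obtain rfl : π = π' := funext hπ
  rfl

variable [Countable X] [DiscreteMeasurableSpace X] [Countable A] [DiscreteMeasurableSpace A]

theorem integral_sum_reward_eq_toReal {n : ℕ} (μ : Measure (Fin n → X × A × ℝ))
    (h : ∀ᵐ τ ∂μ, ∀ i, (τ i).2.2 ∈ Set.Icc (0 : ℝ) 1) :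
    ∫ τ, ∑ i, (τ i).2.2 ∂μ = (∫⁻ τ, ∑ i, ENNReal.ofReal (τ i).2.2 ∂μ).toReal := by
  rw [integral_eq_lintegral_of_nonneg_ae]
  · congr 1
    refine lintegral_congr_ae ?_
    filter_upwards [h] with τ hτ
    exact ENNReal.ofReal_sum_of_nonneg fun i _ => (hτ i).1
  · filter_upwards [h] with τ hτ
    exact Finset.sum_nonneg fun i _ => (hτ i).1
  · exact Measurable.aestronglyMeasurable (by fun_prop)

theorem lintegral_sum_reward_le {n : ℕ} (μ : Measure (Fin n → X × A × ℝ)) [IsProbabilityMeasure μ]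
    (h : ∀ᵐ τ ∂μ, ∀ i, (τ i).2.2 ∈ Set.Icc (0 : ℝ) 1) :
    ∫⁻ τ, ∑ i, ENNReal.ofReal (τ i).2.2 ∂μ ≤ n := by
  calc ∫⁻ τ, ∑ i, ENNReal.ofReal (τ i).2.2 ∂μ ≤ ∫⁻ _, (n : ℝ≥0∞) ∂μ := by
        refine lintegral_mono_ae ?_
        filter_upwards [h] with τ hτ
        calc ∑ i, ENNReal.ofReal (τ i).2.2 ≤ ∑ _i : Fin n, (1 : ℝ≥0∞) :=
              Finset.sum_le_sum fun i _ => ENNReal.ofReal_le_one.2 (hτ i).2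
          _ = n := by simp
    _ = n := by simp

theorem ae_rolloutLaw_reward_mem {n : ℕ} {R : Fin n → X → A → Measure ℝ}
    (hR : ∀ i x a, IsProbabilityMeasure (R i x a))
    (hR' : ∀ i x a, ∀ᵐ r ∂(R i x a), r ∈ Set.Icc (0 : ℝ) 1) (P : Fin n → X → A → PMF X)
    (π : Fin n → X → PMF A) (x : X) :
    ∀ᵐ τ ∂rolloutLaw n R P π x, ∀ i, (τ i).2.2 ∈ Set.Icc (0 : ℝ) 1 :=
  ae_rolloutLaw n R hR P π x (fun _ s => s.2.2 ∈ Set.Icc (0 : ℝ) 1)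
    (fun _ => (measurable_snd.comp measurable_snd) measurableSet_Icc)
    fun i x => ae_of_all _ fun a => hR' i x a

/-- Bellman equation for rollouts whose first action is deterministic. -/
theorem rolloutValue_succ {n : ℕ} {R : Fin (n + 1) → X → A → Measure ℝ}
    (hR : ∀ i x a, IsProbabilityMeasure (R i x a))
    (hR' : ∀ i x a, ∀ᵐ r ∂(R i x a), r ∈ Set.Icc (0 : ℝ) 1) (P : Fin (n + 1) → X → A → PMF X)
    (π : Fin (n + 1) → X → PMF A) (x : X) (a : A) (ha : π 0 x = PMF.pure a) :
    rolloutValue (n + 1) R P π x = ∫ r, r ∂(R 0 x a) +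
      ∫ x', rolloutValue n (Fin.tail R) (Fin.tail P) (Fin.tail π) x' ∂(P 0 x a).toMeasure := by
  have := hR
  have ih := isProbabilityMeasure_rolloutLaw n (Fin.tail R) (fun i => hR i.succ)
    (Fin.tail P) (Fin.tail π)
  have hae := fun x' => ae_rolloutLaw_reward_mem (R := Fin.tail R) (fun i => hR i.succ)
    (fun i => hR' i.succ) (Fin.tail P) (Fin.tail π) x'
  have hfin := fun x' => (lintegral_sum_reward_le _ (hae x')).trans_lt (ENNReal.natCast_lt_top n)
  rw [rolloutValue, integral_sum_reward_eq_toReal _ (ae_rolloutLaw_reward_mem hR hR' P π x),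
    lintegral_rolloutLaw_succ R hR P π x (by fun_prop), ha, PMF.toMeasure_pure, lintegral_dirac]
  simp only [Fin.sum_univ_succ, Fin.cons_zero, Fin.cons_succ]
  have h1 : ∀ r : ℝ, ∫⁻ x', ∫⁻ τ, (ENNReal.ofReal r + ∑ i : Fin n, ENNReal.ofReal (τ i).2.2)
      ∂rolloutLaw n (Fin.tail R) (Fin.tail P) (Fin.tail π) x' ∂(P 0 x a).toMeasure =
      ENNReal.ofReal r + ∫⁻ x', ∫⁻ τ, ∑ i : Fin n, ENNReal.ofReal (τ i).2.2
      ∂rolloutLaw n (Fin.tail R) (Fin.tail P) (Fin.tail π) x' ∂(P 0 x a).toMeasure := by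
    intro r
    have h2 : ∀ x', ∫⁻ τ, (ENNReal.ofReal r + ∑ i : Fin n, ENNReal.ofReal (τ i).2.2)
      ∂rolloutLaw n (Fin.tail R) (Fin.tail P) (Fin.tail π) x' = ENNReal.ofReal r +
        ∫⁻ τ, ∑ i : Fin n, ENNReal.ofReal (τ i).2.2
          ∂rolloutLaw n (Fin.tail R) (Fin.tail P) (Fin.tail π) x' := by
      intro x'
      rw [lintegral_add_left measurable_const]
      simp
    simp only [h2]
    rw [lintegral_add_left measurable_const]
    simp
  simp only [h1]
  rw [lintegral_add_left (by fun_prop), ENNReal.toReal_add]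
  · congr 1
    · rw [integral_eq_lintegral_of_nonneg_ae _ (by fun_prop)]
      filter_upwards [hR' 0 x a] with r hr using hr.1
    · simp only [lintegral_const, measure_univ, mul_one]
      rw [← integral_toReal (Measurable.of_discrete).aemeasurable (ae_of_all _ hfin)]
      refine integral_congr_ae (ae_of_all _ fun x' => ?_)
      exact (integral_sum_reward_eq_toReal _ (hae x')).symm
  · refine ne_top_of_le_ne_top ENNReal.one_ne_top ?_
    calc ∫⁻ r, ENNReal.ofReal r ∂(R 0 x a) ≤ ∫⁻ _, 1 ∂(R 0 x a) := by
          refine lintegral_mono_ae ?_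
          filter_upwards [hR' 0 x a] with r hr using ENNReal.ofReal_le_one.2 hr.2
      _ = 1 := by simp
  · simp only [lintegral_const, measure_univ, mul_one]
    refine ne_top_of_le_ne_top (ENNReal.natCast_ne_top n) ?_
    calc _ ≤ ∫⁻ _ : X, (n : ℝ≥0∞) ∂(P 0 x a).toMeasure :=
          lintegral_mono fun x' => lintegral_sum_reward_le _ (hae x')
      _ = n := by simp

namespace MDP

variable {H : ℕ} (M : MDP X A H)

theorem V_eq_rolloutValue (π : Policy X A H) (h : Fin H) :
    M.V π h = rolloutValue (H - h) (fromLayer h M.R) (fromLayer h M.P) (fromLayer h π) := rfl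

/-- Bellman equation at a state in which the policy is deterministic. -/
theorem V_eq_backup (π : Policy X A H) (h : Fin H) (x : X) (a : A) (ha : π h x = PMF.pure a) :
    M.V π h x = M.backup h
      (fun x' => if hh : (h : ℕ) + 1 < H then M.V π ⟨h + 1, hh⟩ x' else 0) (x, a) := by
  obtain ⟨m, hm⟩ : ∃ m, H - (h : ℕ) = m + 1 := ⟨H - h - 1, by omega⟩
  rw [V_eq_rolloutValue, rolloutValue_congr hm.symm
    (R' := fun i => M.R ⟨h + i, by omega⟩) (P' := fun i => M.P ⟨h + i, by omega⟩)
    (π' := fun i => π ⟨h + i, by omega⟩) (fun i => rfl) (fun i => rfl) (fun i => rfl),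
    rolloutValue_succ (fun i => M.isProbabilityMeasure_R _) (fun i => M.R_mem_Icc _) _ _ x a ha,
    backup]
  congr 1
  refine integral_congr_ae (ae_of_all _ fun x' => ?_)
  dsimp only
  split_ifs with hh
  · rw [V_eq_rolloutValue]
    refine congrFun (rolloutValue_congr (by simp; omega) (fun i => ?_) (fun i => ?_)
      (fun i => ?_)) x'
    all_goals
      simp only [Fin.tail, fromLayer]
      congr 1
      ext
      simp
      omega
  · obtain rfl : m = 0 := by omega
    simp [rolloutValue]

theorem V_update_of_lt (π : Policy X A H) (h h' : Fin H) (hh : h < h') (q : X → PMF A) :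
    M.V (Function.update π h q) h' = M.V π h' := by
  rw [V_eq_rolloutValue, V_eq_rolloutValue]
  congr 1
  funext i
  refine Function.update_of_ne ?_ _ _
  intro e
  have := congrArg Fin.val e
  simp at this
  omega

theorem Q_eq_backup_V (π : Policy X A H) (h : Fin H) (x : X) (a : A) :
    M.Q π h x a = M.backup h
      (fun x' => if hh : (h : ℕ) + 1 < H then M.V π ⟨h + 1, hh⟩ x' else 0) (x, a) := by
  rw [Q, V_eq_backup M _ h x a (by simp)]
  congr 1
  funext x'
  split_ifs with hh
  · rw [V_update_of_lt]
    exact Fin.lt_def.2 (by simp)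
  · rfl

theorem V_eq_Q (d : DetPolicy X A H) (h : Fin H) (x : X) :
    M.V d.toPolicy h x = M.Q d.toPolicy h x (d h x) := by
  rw [Q_eq_backup_V, V_eq_backup M _ h x (d h x) rfl]

variable {M} in
theorem stateValue_Q {d : DetPolicy X A H} (hd : M.IsOptimal d.toPolicy) (k : ℕ) (x : X) :
    stateValue (M.Q d.toPolicy) k x = if hk : k < H then M.V d.toPolicy ⟨k, hk⟩ x else 0 := by
  by_cases hk : k < H
  · have hle : ∀ a, M.Q d.toPolicy ⟨k, hk⟩ x a ≤ M.Q d.toPolicy ⟨k, hk⟩ x (d ⟨k, hk⟩ x) := by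
      intro a
      rw [← V_eq_Q]
      exact hd _ _ _
    have : Nonempty A := ⟨d ⟨k, hk⟩ x⟩
    rw [stateValue, dif_pos hk, dif_pos hk, V_eq_Q]
    refine le_antisymm (ciSup_le hle) (le_ciSup (f := fun a => M.Q d.toPolicy ⟨k, hk⟩ x a)
      ⟨M.Q d.toPolicy ⟨k, hk⟩ x (d ⟨k, hk⟩ x), ?_⟩ (d ⟨k, hk⟩ x))
    rintro _ ⟨a, rfl⟩
    exact hle a
  · simp [stateValue, hk]

variable {M} in
/-- Bellman optimality equation. -/
theorem Q_eq_backup {d : DetPolicy X A H} (hd : M.IsOptimal d.toPolicy) (h : Fin H) (p : X × A) :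
    M.Q d.toPolicy h p.1 p.2 = M.backup h (stateValue (M.Q d.toPolicy) (h + 1)) p := by
  rw [Q_eq_backup_V]
  congr 1
  funext x'
  exact (stateValue_Q hd _ x').symm

theorem J_eq_integral_V [NeZero H] (π : Policy X A H) :
    M.J π = ∫ x, M.V π 0 x ∂M.d₁.toMeasure := by
  have hae := ae_rolloutLaw_reward_mem M.isProbabilityMeasure_R M.R_mem_Icc M.P π
  have := isProbabilityMeasure_rolloutLaw H M.R M.isProbabilityMeasure_R M.P π
  have hfin := fun x => (lintegral_sum_reward_le _ (hae x)).trans_lt (ENNReal.natCast_lt_top H)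
  have hV : M.V π 0 = rolloutValue H M.R M.P π := by
    rw [V_eq_rolloutValue]
    refine (rolloutValue_congr (by simp) (fun i => ?_) (fun i => ?_) (fun i => ?_)).symm
    all_goals
      simp only [fromLayer]
      congr 1
      ext
      simp
      rfl
  rw [J, integral_sum_reward_eq_toReal _ (M.ae_reward_mem π), lintegral_trajLaw M π (by fun_prop),
    ← integral_toReal (Measurable.of_discrete).aemeasurable (ae_of_all _ hfin), hV]
  exact integral_congr_ae (ae_of_all _ fun x => (integral_sum_reward_eq_toReal _ (hae x)).symm)

theorem J_nonneg (π : Policy X A H) : 0 ≤ M.J π := by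
  rw [J, integral_sum_reward_eq_toReal _ (M.ae_reward_mem π)]
  exact ENNReal.toReal_nonneg

end MDP

end Values

/-! ### Exponential supermartingales for adaptively collected data -/

section Concentration

/-- Composition with a choice rule of finite range is measurable. -/
theorem measurable_apply_rule {Ω V β : Type*} [MeasurableSpace Ω] [MeasurableSpace β]
    (F : Finset V) {r : Ω → V} (hmem : ∀ ω, r ω ∈ F) (hr : ∀ f, MeasurableSet {ω | r ω = f})
    {Φ : V → Ω → β} (hΦ : ∀ f, Measurable (Φ f)) : Measurable fun ω => Φ (r ω) ω := by
  intro S hS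
  have : (fun ω => Φ (r ω) ω) ⁻¹' S = ⋃ f ∈ F, {ω | r ω = f} ∩ Φ f ⁻¹' S := by
    ext ω
    simp only [Set.mem_preimage, Set.mem_iUnion, Set.mem_inter_iff, Set.mem_ofPred_eq]
    constructor
    · exact fun h => ⟨r ω, hmem ω, rfl, h⟩
    · rintro ⟨f, _, rfl, h⟩
      exact h
  rw [this]
  exact Finset.measurableSet_biUnion F fun f _ => (hr f).inter (hΦ f hS)

variable {X A : Type*} {H : ℕ}

/-- The value function selected in round `t` of a run. -/
def selected {K T : ℕ} (rule : (n : ℕ) → Data X A H K n → ValueFn X A H)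
    (D : Data X A H K T) (t : Fin T) : ValueFn X A H :=
  rule t fun i => D (Fin.castLE t.isLt.le i)

theorem selected_snoc_castSucc {K n : ℕ} (rule : (n : ℕ) → Data X A H K n → ValueFn X A H)
    (D : Data X A H K n) (b : Fin K → Traj X A H) (i : Fin n) :
    selected rule (Fin.snoc (α := fun _ => Fin K → Traj X A H) D b) i.castSucc =
      selected rule D i := by
  unfold selected
  congr 1
  funext j
  exact Fin.snoc_castSucc (α := fun _ => Fin K → Traj X A H) b D (Fin.castLE i.isLt.le j)

theorem selected_snoc_last {K n : ℕ} (rule : (n : ℕ) → Data X A H K n → ValueFn X A H)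
    (D : Data X A H K n) (b : Fin K → Traj X A H) :
    selected rule (Fin.snoc (α := fun _ => Fin K → Traj X A H) D b) (Fin.last n) =
      rule n D := by
  unfold selected
  change rule n _ = _
  congr 1
  funext j
  exact Fin.snoc_castSucc (α := fun _ => Fin K → Traj X A H) b D j

variable [MeasurableSpace X] [MeasurableSpace A]
  [Countable X] [DiscreteMeasurableSpace X] [Countable A] [DiscreteMeasurableSpace A]
  (M : MDP X A H) (F : Finset (ValueFn X A H)) (π : ValueFn X A H → DetPolicy X A H)
  {rule : (n : ℕ) → Data X A H 1 n → ValueFn X A H}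

theorem measurable_snoc {K n : ℕ} :
    Measurable fun q : Data X A H K n × (Fin K → Traj X A H) =>
      (Fin.snoc (α := fun _ => Fin K → Traj X A H) q.1 q.2 : Data X A H K (n + 1)) := by
  refine measurable_pi_iff.2 fun i => ?_
  refine Fin.lastCases ?_ (fun j => ?_) i
  · simp only [Fin.snoc_last]; fun_prop
  · simp only [Fin.snoc_castSucc]; fun_prop

theorem measurable_selected_apply {T : ℕ} (hmem : ∀ n D, rule n D ∈ F)
    (hmeas : ∀ n f, MeasurableSet {D | rule n D = f}) {β : Type*} [MeasurableSpace β]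
    {Φ : ValueFn X A H → Data X A H 1 T → β} (hΦ : ∀ f, Measurable (Φ f)) (i : Fin T) :
    Measurable fun D => Φ (selected rule D i) D := by
  refine measurable_apply_rule F (fun D => hmem _ _) (fun f => ?_) hΦ
  exact measurableSet_preimage (f := fun D : Data X A H 1 T => fun j : Fin (i : ℕ) =>
    D (Fin.castLE i.isLt.le j)) (by fun_prop) (hmeas i f)

theorem measurable_step {n : ℕ} (hmem : ∀ n D, rule n D ∈ F)
    (hmeas : ∀ n f, MeasurableSet {D | rule n D = f}) :
    Measurable fun D : Data X A H 1 n =>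
      (Measure.pi fun _ : Fin 1 => M.trajLaw (π (rule n D)).toPolicy).map
        fun b => Fin.snoc (α := fun _ => Fin 1 → Traj X A H) D b := by
  refine measurable_apply_rule F (hmem n) (hmeas n)
    (Φ := fun f D => (Measure.pi fun _ : Fin 1 => M.trajLaw (π f).toPolicy).map
        fun b => Fin.snoc (α := fun _ => Fin 1 → Traj X A H) D b) fun f => ?_
  refine Measure.measurable_of_measurable_coe _ fun S hS => ?_
  have h1 : ∀ D : Data X A H 1 n, ((Measure.pi fun _ : Fin 1 => M.trajLaw (π f).toPolicy).map
        fun b => (Fin.snoc (α := fun _ => Fin 1 → Traj X A H) D b : Data X A H 1 (n + 1))) S =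
      (Measure.pi fun _ : Fin 1 => M.trajLaw (π f).toPolicy) (Prod.mk D ⁻¹'
        ((fun q : Data X A H 1 n × (Fin 1 → Traj X A H) =>
      (Fin.snoc (α := fun _ => Fin 1 → Traj X A H) q.1 q.2 : Data X A H 1 (n + 1))) ⁻¹' S)) :=
    fun D => Measure.map_apply (measurable_snoc.comp measurable_prodMk_left) hS
  simp only [h1]
  exact measurable_measure_prodMk_left (measurable_snoc hS)

/-- The product of the one-step factors is a supermartingale started at `1`. -/
theorem lintegral_prod_runLaw_le_one (hmem : ∀ n D, rule n D ∈ F)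
    (hmeas : ∀ n f, MeasurableSet {D | rule n D = f})
    (φ : ℕ → ValueFn X A H → Traj X A H → ℝ≥0∞) (hφ : ∀ n f, Measurable (φ n f))
    (h1 : ∀ n, ∀ f ∈ F, ∫⁻ τ, φ n f τ ∂M.trajLaw (π f).toPolicy ≤ 1) (n : ℕ) :
    ∫⁻ D, ∏ i : Fin n, φ i (selected rule D i) (D i 0) ∂runLaw M π rule n ≤ 1 := by
  have hm : ∀ n, Measurable fun D : Data X A H 1 n =>
      ∏ i : Fin n, φ i (selected rule D i) (D i 0) := fun n =>
    Finset.measurable_prod _ fun i _ => measurable_selected_apply F hmem hmeas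
      (Φ := fun f D => φ i f (D i 0)) (fun f => (hφ i f).comp (by fun_prop)) i
  induction n with
  | zero => simp [runLaw]
  | succ n ih =>
    rw [runLaw, Measure.lintegral_bind (measurable_step M F π hmem hmeas).aemeasurable
      (hm _).aemeasurable]
    refine le_trans (lintegral_mono fun D => ?_) ih
    have hs : Measurable fun b : Fin 1 → Traj X A H =>
        (Fin.snoc (α := fun _ => Fin 1 → Traj X A H) D b : Data X A H 1 (n + 1)) :=
      measurable_snoc.comp measurable_prodMk_left
    rw [lintegral_map (hm _) hs]
    simp only [Fin.prod_univ_castSucc, selected_snoc_castSucc, selected_snoc_last,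
      Fin.snoc_castSucc, Fin.snoc_last, Fin.val_castSucc, Fin.val_last]
    rw [lintegral_const_mul _ (f := fun b : Fin 1 → Traj X A H => φ n (rule n D) (b 0))
      ((hφ n _).comp (measurable_pi_apply 0))]
    have h2 : ∫⁻ b : Fin 1 → Traj X A H, φ n (rule n D) (b 0)
        ∂(Measure.pi fun _ : Fin 1 => M.trajLaw (π (rule n D)).toPolicy) =
        ∫⁻ τ, φ n (rule n D) τ ∂M.trajLaw (π (rule n D)).toPolicy :=
      (measurePreserving_eval (fun _ : Fin 1 => M.trajLaw (π (rule n D)).toPolicy)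
        0).lintegral_comp (hφ n _)
    rw [h2]
    exact mul_le_of_le_one_right' (h1 n _ (hmem n D))

theorem sum_ite_lt_eq_sum_castLE {n T : ℕ} (hn : n ≤ T) (g : Fin T → ℝ) :
    (∑ i : Fin T, if (i : ℕ) < n then g i else 0) = ∑ i : Fin n, g (Fin.castLE hn i) := by
  rw [← Finset.sum_filter]
  symm
  refine Finset.sum_bij (fun i _ => Fin.castLE hn i) (fun i _ => by simp) (fun i _ j _ h => ?_)
    (fun j hj => ?_) fun i _ => rfl
  · exact Fin.castLE_injective hn h
  · exact ⟨⟨j, by simpa using hj⟩, Finset.mem_univ _, rfl⟩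

/-- Chernoff bound for sums over the first `n` rounds. -/
theorem runLaw_sum_ge_le {T n : ℕ} (hn : n ≤ T) (hmem : ∀ n D, rule n D ∈ F)
    (hmeas : ∀ n f, MeasurableSet {D | rule n D = f})
    (Y : ValueFn X A H → Traj X A H → ℝ) (hY : ∀ f, Measurable (Y f))
    (h1 : ∀ f ∈ F, ∫⁻ τ, ENNReal.ofReal (Real.exp (Y f τ)) ∂M.trajLaw (π f).toPolicy ≤ 1)
    (s : ℝ) :
    runLaw M π rule T {D | s ≤ ∑ i : Fin n, Y (selected rule D (Fin.castLE hn i))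
      (D (Fin.castLE hn i) 0)} ≤ ENNReal.ofReal (Real.exp (-s)) := by
  set φ : ℕ → ValueFn X A H → Traj X A H → ℝ≥0∞ := fun i f τ =>
    ENNReal.ofReal (Real.exp (if i < n then Y f τ else 0)) with hφ
  have hφm : ∀ i f, Measurable (φ i f) := by
    intro i f
    simp only [hφ]
    have := hY f
    split_ifs <;> fun_prop
  have key := lintegral_prod_runLaw_le_one M F π hmem hmeas φ hφm (fun i f hf => by
    simp only [hφ]
    split_ifs
    · exact h1 f hf
    · simp) T
  have hm : Measurable fun D : Data X A H 1 T => ∏ i : Fin T, φ i (selected rule D i) (D i 0) :=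
    Finset.measurable_prod _ fun i _ => measurable_selected_apply F hmem hmeas
      (Φ := fun f D => φ i f (D i 0)) (fun f => (hφm i f).comp (by fun_prop)) i
  have hprod : ∀ D : Data X A H 1 T, ∏ i : Fin T, φ i (selected rule D i) (D i 0) =
      ENNReal.ofReal (Real.exp (∑ i : Fin n, Y (selected rule D (Fin.castLE hn i))
        (D (Fin.castLE hn i) 0))) := by
    intro D
    rw [← sum_ite_lt_eq_sum_castLE hn fun i => Y (selected rule D i) (D i 0), Real.exp_sum,
      ENNReal.ofReal_prod_of_nonneg fun i _ => (Real.exp_pos _).le]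
  have h2 := mul_meas_ge_le_lintegral (μ := runLaw M π rule T) hm (ENNReal.ofReal (Real.exp s))
  have h3 : {D : Data X A H 1 T | s ≤ ∑ i : Fin n, Y (selected rule D (Fin.castLE hn i))
      (D (Fin.castLE hn i) 0)} ⊆ {D | ENNReal.ofReal (Real.exp s) ≤
        ∏ i : Fin T, φ i (selected rule D i) (D i 0)} := by
    intro D hD
    simp only [Set.mem_ofPred_eq, hprod] at hD ⊢
    exact ENNReal.ofReal_le_ofReal (Real.exp_le_exp.2 hD)
  refine (measure_mono h3).trans ?_
  rw [Real.exp_neg, ENNReal.ofReal_inv_of_pos (Real.exp_pos s)]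
  rw [ENNReal.le_inv_iff_mul_le, mul_comm]
  exact h2.trans key

theorem isProbabilityMeasure_runLaw (hmem : ∀ n D, rule n D ∈ F)
    (hmeas : ∀ n f, MeasurableSet {D | rule n D = f}) (n : ℕ) :
    IsProbabilityMeasure (runLaw M π rule n) := by
  induction n with
  | zero => unfold runLaw; infer_instance
  | succ n ih =>
    unfold runLaw
    exact isProbabilityMeasure_bind (measurable_step M F π hmem hmeas).aemeasurable
      (ae_of_all _ fun D => Measure.isProbabilityMeasure_map
        (measurable_snoc.comp measurable_prodMk_left).aemeasurable)

end Concentration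

/-! ### Exponential moments -/

section ExponentialMoments

theorem exp_le_one_add_add_sq {x : ℝ} (hx : |x| ≤ 1) : Real.exp x ≤ 1 + x + x ^ 2 := by
  have := (abs_le.1 (Real.abs_exp_sub_one_sub_id_le hx)).2
  linarith

theorem lintegral_ofReal_exp_le_one {Ω : Type*} [MeasurableSpace Ω] {μ : Measure Ω}
    {Y g : Ω → ℝ} (hg : Integrable g μ)
    (hYg : ∀ᵐ ω ∂μ, Real.exp (Y ω) ≤ g ω) (h1 : ∫ ω, g ω ∂μ ≤ 1) :
    ∫⁻ ω, ENNReal.ofReal (Real.exp (Y ω)) ∂μ ≤ 1 := by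
  calc ∫⁻ ω, ENNReal.ofReal (Real.exp (Y ω)) ∂μ ≤ ∫⁻ ω, ENNReal.ofReal (g ω) ∂μ := by
        refine lintegral_mono_ae ?_
        filter_upwards [hYg] with ω hω using ENNReal.ofReal_le_ofReal hω
    _ = ENNReal.ofReal (∫ ω, g ω ∂μ) := by
        rw [ofReal_integral_eq_lintegral_ofReal hg]
        filter_upwards [hYg] with ω hω using (Real.exp_pos _).le.trans hω
    _ ≤ 1 := ENNReal.ofReal_le_one.2 h1

/-- Bernstein-type exponential moment bound for a bounded variable, with the second moment in
place of the variance. -/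
theorem lintegral_exp_bernstein {Ω : Type*} [MeasurableSpace Ω] {μ : Measure Ω}
    [IsProbabilityMeasure μ] {Z : Ω → ℝ} (hZ : Measurable Z) {b : ℝ}
    (hb : ∀ᵐ ω ∂μ, |Z ω| ≤ b) (l : ℝ) (hl : |l| * b ≤ 1) :
    ∫⁻ ω, ENNReal.ofReal (Real.exp
      (l * ∫ ω, Z ω ∂μ - l * Z ω - l ^ 2 * ∫ ω, Z ω ^ 2 ∂μ)) ∂μ ≤ 1 := by
  have hi : Integrable Z μ := Integrable.of_bound hZ.aestronglyMeasurable b hb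
  have hi2 : Integrable (fun ω => Z ω ^ 2) μ := by
    refine Integrable.of_bound (hZ.pow_const 2).aestronglyMeasurable (b ^ 2) ?_
    filter_upwards [hb] with ω hω
    rw [Real.norm_eq_abs, abs_pow]
    exact pow_le_pow_left₀ (abs_nonneg _) hω 2
  set m := ∫ ω, Z ω ∂μ with hm
  set v := ∫ ω, Z ω ^ 2 ∂μ with hv
  have hg : Integrable (fun ω => (1 - l * Z ω) + l ^ 2 * Z ω ^ 2) μ :=
    ((integrable_const _).sub (hi.const_mul _)).add (hi2.const_mul _)
  refine lintegral_ofReal_exp_le_one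
    (g := fun ω => Real.exp (l * m - l ^ 2 * v) * ((1 - l * Z ω) + l ^ 2 * Z ω ^ 2))
    (hg.const_mul _) ?_ ?_
  · filter_upwards [hb] with ω hω
    have h1 : |-(l * Z ω)| ≤ 1 := by
      rw [abs_neg, abs_mul]
      exact (mul_le_mul_of_nonneg_left hω (abs_nonneg l)).trans hl
    have h2 := exp_le_one_add_add_sq h1
    rw [show l * m - l * Z ω - l ^ 2 * v = (l * m - l ^ 2 * v) + -(l * Z ω) by ring, Real.exp_add]
    refine mul_le_mul_of_nonneg_left (h2.trans (le_of_eq (by ring))) (Real.exp_pos _).le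
  · have hsub : Integrable (fun ω => 1 - l * Z ω) μ := (integrable_const _).sub (hi.const_mul _)
    rw [integral_const_mul, integral_add hsub (hi2.const_mul _),
      integral_sub (integrable_const _) (hi.const_mul _), integral_const_mul,
      integral_const_mul, ← hm, ← hv]
    simp only [integral_const, probReal_univ, one_smul]
    have h3 := Real.add_one_le_exp (-(l * m - l ^ 2 * v))
    calc Real.exp (l * m - l ^ 2 * v) * (1 - l * m + l ^ 2 * v)
        ≤ Real.exp (l * m - l ^ 2 * v) * Real.exp (-(l * m - l ^ 2 * v)) :=
          mul_le_mul_of_nonneg_left (by linarith) (Real.exp_pos _).le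
      _ = 1 := by rw [← Real.exp_add]; simp

end ExponentialMoments

/-! ### Bellman errors -/

section BellmanErrors

variable {X A : Type*} {H : ℕ} [MeasurableSpace X] [MeasurableSpace A]
  [Countable X] [DiscreteMeasurableSpace X] [Countable A] [DiscreteMeasurableSpace A]
  (M : MDP X A H)

/-- The Bellman error `f_h - 𝒯_h f_{h+1}`. -/
noncomputable def MDP.bellmanError (f : ValueFn X A H) (h : Fin H) (p : X × A) : ℝ :=
  f h p.1 p.2 - M.backup h (stateValue f (h + 1)) p

theorem measurable_residual (f : ValueFn X A H) (h : Fin H) : Measurable (residual f h) := by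
  have h1 := measurable_nextVal (A := A) (stateValue f (h + 1)) h
  have h2 : Measurable fun τ : Traj X A H => f h (τ h).1 (τ h).2.1 :=
    (Measurable.of_discrete (f := fun p : X × A => f h p.1 p.2)).comp
      (f := fun τ : Traj X A H => ((τ h).1, (τ h).2.1)) (by fun_prop)
  simp only [funext (residual_eq f h)]
  fun_prop

variable {f : ValueFn X A H} (hf : ∀ h x a, f h x a ∈ Set.Icc (0 : ℝ) 1)
include hf

theorem abs_residual_le {h : Fin H} {τ : Traj X A H} (hτ : (τ h).2.2 ∈ Set.Icc (0 : ℝ) 1) :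
    |residual f h τ| ≤ 2 := by
  have h1 := abs_le.1 (abs_nextVal_le (A := A) (abs_stateValue_le hf (h + 1)) h τ)
  have h0 : 0 ≤ nextVal (stateValue f (h + 1)) h τ := by
    unfold nextVal
    split_ifs
    · unfold stateValue
      split_ifs
      exact Real.iSup_nonneg fun a => (hf _ _ a).1
    · exact le_rfl
  have h2 := hf h (τ h).1 (τ h).2.1
  rw [residual_eq, abs_le]
  constructor <;> linarith [h2.1, h2.2, hτ.1, hτ.2]

theorem abs_backup_le (h : Fin H) (p : X × A) :
    |M.backup h (stateValue f (h + 1)) p| ≤ 2 := by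
  have := M.isProbabilityMeasure_R
  have h1 : ‖∫ r, r ∂(M.R h p.1 p.2)‖ ≤ 1 * (M.R h p.1 p.2).real Set.univ := by
    refine norm_integral_le_of_norm_le_const ?_
    filter_upwards [M.R_mem_Icc h p.1 p.2] with r hr
    rw [Real.norm_eq_abs, abs_of_nonneg hr.1]
    exact hr.2
  have h2 : ‖∫ x', stateValue f (h + 1) x' ∂(M.P h p.1 p.2).toMeasure‖ ≤
      1 * (M.P h p.1 p.2).toMeasure.real Set.univ :=
    norm_integral_le_of_norm_le_const (ae_of_all _ (abs_stateValue_le hf _))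
  simp only [probReal_univ, Real.norm_eq_abs, mul_one] at h1 h2
  exact (abs_add_le _ _).trans (by linarith)

theorem abs_bellmanError_le (h : Fin H) (p : X × A) : |M.bellmanError f h p| ≤ 3 := by
  have h1 := abs_backup_le M hf h p
  have h2 := hf h p.1 p.2
  unfold MDP.bellmanError
  rw [abs_le] at h1 ⊢
  constructor <;> linarith [h2.1, h2.2, h1.1, h1.2]

theorem integral_residual_mul (π : Policy X A H) (h : Fin H) {u : X × A → ℝ} {B : ℝ}
    (hu : ∀ p, |u p| ≤ B) :
    ∫ τ, residual f h τ * u ((τ h).1, (τ h).2.1) ∂M.trajLaw π =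
      ∫ p, M.bellmanError f h p * u p ∂M.occMeasure π h := by
  have hm := measurable_nextVal (A := A) (stateValue f (h + 1)) h
  have hum : Measurable fun τ : Traj X A H => u ((τ h).1, (τ h).2.1) :=
    (Measurable.of_discrete (f := u)).comp (by fun_prop)
  have hfu : ∀ p : X × A, |f h p.1 p.2 * u p| ≤ 1 * B := fun p => by
    rw [abs_mul, abs_of_nonneg (hf h p.1 p.2).1]
    exact mul_le_mul (hf h p.1 p.2).2 (hu p) (abs_nonneg _) zero_le_one
  have h1 : ∫ τ, f h (τ h).1 (τ h).2.1 * u ((τ h).1, (τ h).2.1) ∂M.trajLaw π =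
      ∫ p, f h p.1 p.2 * u p ∂M.occMeasure π h := by
    rw [MDP.occMeasure, integral_map (by fun_prop)
      (Measurable.of_discrete (f := fun p : X × A => f h p.1 p.2 * u p)).aestronglyMeasurable]
  have h2 := M.integral_target_mul π h (abs_stateValue_le hf (h + 1))
    (stateValue_eq_zero f h) hu
  simp only [residual_eq, MDP.bellmanError, sub_mul]
  rw [integral_sub, integral_sub, h1, h2]
  · exact integrable_of_forall_bound _ hfu
  · refine integrable_of_forall_bound (B := 2 * B) _ fun p => ?_
    rw [abs_mul]
    exact mul_le_mul (abs_backup_le M hf h p) (hu p) (abs_nonneg _) zero_le_two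
  · refine Integrable.of_bound (Measurable.aestronglyMeasurable ?_) (1 * B)
      (ae_of_all _ fun τ => hfu ((τ h).1, (τ h).2.1))
    exact (Measurable.of_discrete (f := fun p : X × A => f h p.1 p.2 * u p)).comp
      (f := fun τ : Traj X A H => ((τ h).1, (τ h).2.1)) (by fun_prop)
  · refine Integrable.of_bound (Measurable.aestronglyMeasurable (by fun_prop)) (2 * B) ?_
    filter_upwards [M.ae_reward_mem π] with τ hτ
    have h4 := abs_nextVal_le (A := A) (abs_stateValue_le hf (h + 1)) h τ
    have h3 : |(τ h).2.2| ≤ 1 := by rw [abs_of_nonneg (hτ h).1]; exact (hτ h).2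
    rw [Real.norm_eq_abs, abs_mul]
    exact mul_le_mul ((abs_add_le _ _).trans (by linarith)) (hu _) (abs_nonneg _) zero_le_two

/-- If `f` satisfies the Bellman equation, then the weighted residuals, compensated by their
squared weights, have a bounded exponential moment: conditionally on the state and the action,
the residual is centred. -/
theorem lintegral_exp_residual_le_one (π : Policy X A H) (h : Fin H)
    (hbell : ∀ p, M.bellmanError f h p = 0) {u : X × A → ℝ} {l B : ℝ} (hl : 0 ≤ l)
    (hu : ∀ p, |u p| ≤ B) (hlB : 2 * (l * B) ≤ 1) :
    ∫⁻ τ, ENNReal.ofReal (Real.exp (l * (residual f h τ * u ((τ h).1, (τ h).2.1)) -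
      4 * l ^ 2 * u ((τ h).1, (τ h).2.1) ^ 2)) ∂M.trajLaw π ≤ 1 := by
  -- since `(1 + s) exp (-s) ≤ 1`, the integrand is at most `1` plus a weighted residual, whose mean
  -- vanishes by the Bellman equation
  set u' : X × A → ℝ := fun p => l * u p * Real.exp (-(4 * l ^ 2 * u p ^ 2)) with hu'
  have hu'b : ∀ p, |u' p| ≤ l * B := fun p => by
    rw [hu', abs_mul, abs_of_pos (Real.exp_pos _), abs_mul, abs_of_nonneg hl]
    have h1 : Real.exp (-(4 * l ^ 2 * u p ^ 2)) ≤ 1 := Real.exp_le_one_iff.2 (by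
      have := sq_nonneg (l * u p); nlinarith)
    have h2 := mul_le_mul_of_nonneg_left (hu p) hl
    calc l * |u p| * Real.exp (-(4 * l ^ 2 * u p ^ 2)) ≤ l * |u p| * 1 :=
          mul_le_mul_of_nonneg_left h1 (mul_nonneg hl (abs_nonneg _))
      _ ≤ l * B := by linarith
  have hum : Measurable fun τ : Traj X A H => u ((τ h).1, (τ h).2.1) :=
    (Measurable.of_discrete (f := u)).comp (by fun_prop)
  have hu'm : Measurable fun τ : Traj X A H => u' ((τ h).1, (τ h).2.1) :=
    (Measurable.of_discrete (f := u')).comp (by fun_prop)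
  have hres := measurable_residual f h
  have hint : Integrable (fun τ : Traj X A H => residual f h τ * u' ((τ h).1, (τ h).2.1))
      (M.trajLaw π) := by
    refine Integrable.of_bound (hres.mul hu'm).aestronglyMeasurable (2 * (l * B)) ?_
    filter_upwards [M.ae_reward_mem π] with τ hτ
    rw [Real.norm_eq_abs, abs_mul]
    exact mul_le_mul (abs_residual_le hf (hτ h)) (hu'b _) (abs_nonneg _) zero_le_two
  refine lintegral_ofReal_exp_le_one
    (g := fun τ => 1 + residual f h τ * u' ((τ h).1, (τ h).2.1))
    ((integrable_const _).add hint) ?_ ?_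
  · filter_upwards [M.ae_reward_mem π] with τ hτ
    have hr := abs_residual_le hf (hτ h)
    set r := residual f h τ
    set y := u ((τ h).1, (τ h).2.1) with hy
    have hyB : |y| ≤ B := hu _
    have h1 : |l * (r * y)| ≤ 1 := by
      rw [abs_mul, abs_mul, abs_of_nonneg hl]
      have := mul_le_mul hr hyB (abs_nonneg _) zero_le_two
      have := mul_le_mul_of_nonneg_left this hl
      linarith
    have h2 := exp_le_one_add_add_sq h1
    have hr2 : r ^ 2 ≤ 4 := by rw [← sq_abs]; nlinarith [abs_nonneg r]
    have h3 : (l * (r * y)) ^ 2 ≤ 4 * l ^ 2 * y ^ 2 := by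
      have := mul_le_mul_of_nonneg_right hr2 (sq_nonneg (l * y))
      calc (l * (r * y)) ^ 2 = r ^ 2 * (l * y) ^ 2 := by ring
        _ ≤ 4 * (l * y) ^ 2 := this
        _ = _ := by ring
    set s := 4 * l ^ 2 * y ^ 2 with hs
    have h4 := Real.add_one_le_exp s
    change Real.exp (l * (r * y) - s) ≤ 1 + r * (l * y * Real.exp (-s))
    calc Real.exp (l * (r * y) - s) = Real.exp (l * (r * y)) * Real.exp (-s) := by
          rw [← Real.exp_add]; ring_nf
      _ ≤ (Real.exp s + l * (r * y)) * Real.exp (-s) :=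
          mul_le_mul_of_nonneg_right (by linarith) (Real.exp_pos _).le
      _ = Real.exp s * Real.exp (-s) + r * (l * y * Real.exp (-s)) := by ring
      _ = _ := by rw [← Real.exp_add]; simp
  · rw [integral_add (integrable_const _) hint, integral_residual_mul M hf π h hu'b]
    simp [hbell]

end BellmanErrors

/-! ### The coverage potential -/

section Potential

/-- The quantity `d * min 1 (d / (γ S))`, read as `d` if `S = 0`. -/
noncomputable def potential (γ d S : ℝ) : ℝ := if d ≤ γ * S then d ^ 2 / (γ * S) else d

theorem potential_nonneg {γ d S : ℝ} (hd : 0 ≤ d) : 0 ≤ potential γ d S := by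
  unfold potential
  split_ifs with h
  · exact div_nonneg (sq_nonneg d) (hd.trans h)
  · exact hd

theorem potential_le {γ d S : ℝ} (hd : 0 ≤ d) : potential γ d S ≤ d := by
  unfold potential
  split_ifs with h
  · refine div_le_of_le_mul₀ (hd.trans h) hd ?_
    nlinarith
  · exact le_rfl

theorem potential_le_div {γ d S : ℝ} (hγ : 0 < γ) (hS : 0 < S) :
    potential γ d S ≤ d ^ 2 / (γ * S) := by
  unfold potential
  split_ifs with h
  · exact le_rfl
  · rw [le_div_iff₀ (mul_pos hγ hS)]
    push Not at h
    nlinarith [mul_pos hγ hS]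

/-- If the accumulated mass `S` is below the bound `m`, then the new mass is charged to the growth
of `min S (2 m)`; otherwise it is charged to the growth of a logarithm. -/
theorem potential_step {γ m d S : ℝ} (hγ : 0 < γ) (hm : 0 < m) (hd : 0 ≤ d) (hdm : d ≤ m)
    (hS : 0 ≤ S) :
    min S (2 * m) + 4 * m / γ * Real.log (1 + S / m) + potential γ d S ≤
      min (S + d) (2 * m) + 4 * m / γ * Real.log (1 + (S + d) / m) := by
  have hc : 0 ≤ 4 * m / γ := by positivity
  rcases lt_or_ge S m with h | h
  · rw [min_eq_left (by linarith), min_eq_left (by linarith)]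
    have h1 := potential_le (γ := γ) (S := S) hd
    have h2 : Real.log (1 + S / m) ≤ Real.log (1 + (S + d) / m) :=
      Real.log_le_log (by positivity) (by gcongr; linarith)
    have := mul_le_mul_of_nonneg_left h2 hc
    linarith
  · have hS' : 0 < S := hm.trans_le h
    have h1 := potential_le_div (d := d) hγ hS'
    have h2 : min S (2 * m) ≤ min (S + d) (2 * m) := min_le_min_right _ (by linarith)
    set u := d / (m + S) with hu
    have hu0 : 0 ≤ u := by positivity
    have hu1 : u ≤ 1 := by rw [hu, div_le_one (by linarith)]; linarith
    have h3 : 1 + (S + d) / m = (1 + S / m) * (1 + u) := by rw [hu]; field_simp; ring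
    have h4 : u / 2 ≤ Real.log (1 + u) := by
      refine le_trans ?_ (Real.one_sub_inv_le_log_of_pos (by linarith))
      rw [show 1 - (1 + u)⁻¹ = u / (1 + u) by field_simp; ring]
      exact div_le_div_of_nonneg_left hu0 (by linarith) (by linarith)
    have h5 : d / S ≤ 2 * u := by
      rw [hu, ← mul_div_assoc, div_le_div_iff₀ hS' (by linarith)]
      nlinarith
    have h6 : d ^ 2 / (γ * S) ≤ 4 * m / γ * Real.log (1 + u) := by
      calc d ^ 2 / (γ * S) = d / γ * (d / S) := by field_simp
        _ ≤ m / γ * (4 * Real.log (1 + u)) := by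
          apply mul_le_mul _ (by linarith) (by positivity) (by positivity)
          gcongr
        _ = _ := by ring
    rw [h3, Real.log_mul (by positivity) (by positivity), mul_add]
    linarith

/-- Elliptical-potential-type bound: masses `d n ≤ m` have a total potential of order
`m (1 + γ⁻¹ log T)`. -/
theorem sum_potential_le {γ m : ℝ} (hγ : 0 < γ) {d : ℕ → ℝ} (hd : ∀ n, 0 ≤ d n)
    (hdm : ∀ n, d n ≤ m) (T : ℕ) :
    ∑ n ∈ Finset.range T, potential γ (d n) (∑ i ∈ Finset.range n, d i) ≤
      m * (2 + 4 / γ * Real.log (1 + T)) := by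
  rcases ((hd 0).trans (hdm 0)).eq_or_lt with hm | hm
  · have h0 : ∀ n, d n = 0 := fun n => le_antisymm (hm ▸ hdm n) (hd n)
    simp [h0, potential, ← hm]
  have key : ∀ T : ℕ, ∑ n ∈ Finset.range T, potential γ (d n) (∑ i ∈ Finset.range n, d i) ≤
      min (∑ i ∈ Finset.range T, d i) (2 * m) +
        4 * m / γ * Real.log (1 + (∑ i ∈ Finset.range T, d i) / m) := by
    intro T
    induction T with
    | zero => simp [hm.le]
    | succ T ih =>
      rw [Finset.sum_range_succ, Finset.sum_range_succ d]
      have := potential_step hγ hm (hd T) (hdm T)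
        (Finset.sum_nonneg fun i (_ : i ∈ Finset.range T) => hd i)
      linarith
  refine (key T).trans ?_
  have hS : ∑ i ∈ Finset.range T, d i ≤ T * m := by
    simpa using Finset.sum_le_card_nsmul (Finset.range T) d m fun i _ => hdm i
  have hS0 : 0 ≤ ∑ i ∈ Finset.range T, d i := Finset.sum_nonneg fun i _ => hd i
  have h1 : Real.log (1 + (∑ i ∈ Finset.range T, d i) / m) ≤ Real.log (1 + T) := by
    refine Real.log_le_log (by positivity) ?_
    gcongr
    rwa [div_le_iff₀ hm]
  have h2 := mul_le_mul_of_nonneg_left h1 (show 0 ≤ 4 * m / γ by positivity)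
  have h3 := min_le_right (∑ i ∈ Finset.range T, d i) (2 * m)
  calc _ ≤ 2 * m + 4 * m / γ * Real.log (1 + T) := add_le_add h3 h2
    _ = _ := by ring

end Potential

/-! ### Clipped density ratios -/

section Clipping

theorem clip_nonneg (w : ℝ≥0∞) (G : ℝ) : 0 ≤ clip w G := ENNReal.toReal_nonneg

theorem clip_le (w : ℝ≥0∞) {G : ℝ} (hG : 0 ≤ G) : clip w G ≤ G := by
  unfold clip
  calc _ ≤ (ENNReal.ofReal G).toReal := ENNReal.toReal_mono ENNReal.ofReal_ne_top (min_le_right _ _)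
    _ = G := ENNReal.toReal_ofReal hG

theorem clip_densityRatio {a b : ℝ≥0∞} (ha : a ≠ ∞) (hb : b ≠ 0) {G : ℝ} (hG : 0 ≤ G) :
    clip (densityRatio a b) G = min (a.toReal / b.toReal) G := by
  have h1 : densityRatio a b = a / b := by simp [densityRatio, hb]
  rw [clip, h1, ENNReal.toReal_min (ENNReal.div_ne_top ha hb) ENNReal.ofReal_ne_top,
    ENNReal.toReal_div, ENNReal.toReal_ofReal hG]

theorem le_mul_of_densityRatio_le {p q c : ℝ≥0∞} (hq : q ≠ ∞) (hc : c ≠ ∞)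
    (h : densityRatio p q ≤ c) : p ≤ c * q := by
  unfold densityRatio at h
  split_ifs at h with h0
  · simp [h0.1]
  · rcases eq_or_ne q 0 with rfl | hq0
    · rw [ENNReal.div_zero fun hp => h0 ⟨hp, rfl⟩] at h
      exact absurd (top_le_iff.1 h) hc
    · exact (ENNReal.div_le_iff hq0 hq).1 h

variable {d S n γ G ω : ℝ}

/-- Change of measure from a density `d` to the mixture `S / n` costs at most the potential,
and so does the second moment of the clipped ratio. -/
theorem clipped_ratio_bounds (hγ : 0 < γ) (hn : 0 < n) (hd : 0 ≤ d) (hS : 0 ≤ S)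
    (hG : G = γ * (n + 1)) (hω0 : 0 ≤ ω) (hωG : ω ≤ G)
    (hω : S ≠ 0 → ω = min (d / (S / n)) G) :
    0 ≤ d - S * ω / n ∧ d - S * ω / n ≤ potential γ d S ∧
      S * ω ^ 2 / n / G ≤ potential γ d S := by
  have hGpos : 0 < G := by rw [hG]; positivity
  rcases hS.eq_or_lt with hS0 | hS0
  · subst hS0
    have hp := potential_nonneg (γ := γ) (S := 0) hd
    refine ⟨by simpa using hd, ?_, by simpa using hp⟩
    unfold potential
    split_ifs with h
    · simp at h
      simp [le_antisymm h hd]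
    · simp
  have hω := hω hS0.ne'
  have hle : ω ≤ d / (S / n) := hω ▸ min_le_left _ _
  have hSω : S * ω / n ≤ d := by
    rw [le_div_iff₀ (by positivity)] at hle
    calc S * ω / n = ω * (S / n) := by ring
      _ ≤ d := hle
  refine ⟨by linarith, ?_, ?_⟩
  · unfold potential
    split_ifs with h
    · have h1 : ω = d / (S / n) := by
        rw [hω]
        refine min_eq_left ?_
        rw [div_le_iff₀ (by positivity), hG]
        calc d ≤ γ * S := h
          _ ≤ γ * S * ((n + 1) / n) := le_mul_of_one_le_right (by positivity)
              (by rw [le_div_iff₀ hn]; linarith)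
          _ = _ := by ring
      have h2 : S * ω / n = d := by rw [h1]; field_simp
      rw [h2, sub_self]
      positivity
    · have : 0 ≤ S * ω / n := by positivity
      linarith
  · have h1 : S * ω ^ 2 / n / G ≤ d * (ω / G) := by
      calc S * ω ^ 2 / n / G = S * ω / n * (ω / G) := by ring
        _ ≤ _ := mul_le_mul_of_nonneg_right hSω (by positivity)
    refine h1.trans ?_
    unfold potential
    split_ifs with h
    · rw [sq, mul_div_assoc]
      refine mul_le_mul_of_nonneg_left ?_ hd
      rw [div_le_div_iff₀ hGpos (by positivity)]
      have h3 : ω * S ≤ d * n := by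
        rw [div_le_iff₀ hn] at hSω
        linarith
      calc ω * (γ * S) = γ * (ω * S) := by ring
        _ ≤ γ * (d * n) := by gcongr
        _ ≤ d * G := by rw [hG]; nlinarith [mul_nonneg hγ.le hd]
    · exact mul_le_of_le_one_right hd ((div_le_one hGpos).2 hωG)

end Clipping

/-! ### Coverability -/

section Coverability

variable {X A : Type*} {H : ℕ} [MeasurableSpace X] [MeasurableSpace A]
  [Countable X] [DiscreteMeasurableSpace X] [Countable A] [DiscreteMeasurableSpace A]
  (M : MDP X A H) {F : Finset (ValueFn X A H)} (π : ValueFn X A H → DetPolicy X A H)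

theorem MDP.occ_ne_top (π : Policy X A H) (h : Fin H) (x : X) (a : A) : M.occ π h x a ≠ ∞ :=
  measure_ne_top _ _

theorem MDP.tsum_occ (π : Policy X A H) (h : Fin H) :
    ∑' p : X × A, M.occ π h p.1 p.2 = 1 := by
  have h1 := lintegral_countable' (μ := M.occMeasure π h) fun _ => 1
  simp only [lintegral_const, measure_univ, mul_one, one_mul, M.occMeasure_singleton] at h1
  exact h1.symm

theorem MDP.hasSum_occ_toReal (π : Policy X A H) (h : Fin H) :
    HasSum (fun p : X × A => (M.occ π h p.1 p.2).toReal) 1 := by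
  have h1 := M.tsum_occ π h
  have h2 := ENNReal.hasSum_toReal (f := fun p : X × A => M.occ π h p.1 p.2)
    (by rw [h1]; exact ENNReal.one_ne_top)
  rwa [← ENNReal.tsum_toReal_eq (f := fun p : X × A => M.occ π h p.1 p.2)
    fun p => M.occ_ne_top π h p.1 p.2, h1, ENNReal.toReal_one] at h2

theorem MDP.coverability_ne_top (hF : F.Nonempty) : M.coverability F π ≠ ∞ := by
  refine ne_top_of_le_ne_top (ENNReal.natCast_ne_top F.card) ?_
  -- the uniform mixture of the occupancy measures covers each of them up to the factor `|F|`
  refine iInf_le_of_le (fun h => (PMF.uniformOfFinset F hF).bind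
    fun f => (M.occMeasure (π f).toPolicy h).toPMF) ?_
  refine iSup₂_le fun f hf => iSup_le fun h => iSup_le fun x => iSup_le fun a => ?_
  have hcard : (1 : ℝ≥0∞) ≤ F.card := by exact_mod_cast hF.card_pos
  have hcard0 : (F.card : ℝ≥0∞) ≠ 0 := (zero_lt_one.trans_le hcard).ne'
  have h1 : (F.card : ℝ≥0∞)⁻¹ * M.occ (π f).toPolicy h x a ≤
      (PMF.uniformOfFinset F hF).bind
        (fun f => (M.occMeasure (π f).toPolicy h).toPMF) (x, a) := by
    rw [PMF.bind_apply]
    refine le_trans (le_of_eq ?_) (ENNReal.le_tsum f)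
    rw [PMF.uniformOfFinset_apply_of_mem hF hf, Measure.toPMF_apply, occMeasure_singleton]
  unfold densityRatio
  split_ifs with h0
  · exact hcard
  · refine ENNReal.div_le_of_le_mul ?_
    calc M.occ (π f).toPolicy h x a
        = F.card * ((F.card : ℝ≥0∞)⁻¹ * M.occ (π f).toPolicy h x a) := by
          rw [← mul_assoc, ENNReal.mul_inv_cancel hcard0 (ENNReal.natCast_ne_top _), one_mul]
      _ ≤ _ := mul_le_mul_right h1 _

theorem MDP.one_le_coverability [NeZero H] (hF : F.Nonempty) : 1 ≤ M.coverability F π := by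
  obtain ⟨f, hf⟩ := hF
  refine le_iInf fun μ => ?_
  set c := ⨆ f ∈ F, ⨆ (h : Fin H) (x : X) (a : A),
    densityRatio (M.occ (π f).toPolicy h x a) (μ h (x, a)) with hc
  rcases eq_or_ne c ∞ with h | hctop
  · rw [h]; exact le_top
  have h1 : ∀ p : X × A, M.occ (π f).toPolicy 0 p.1 p.2 ≤ c * μ 0 p := fun p =>
    le_mul_of_densityRatio_le ((μ 0).apply_ne_top p) hctop (le_iSup₂_of_le f hf
      (le_iSup_of_le 0 (le_iSup_of_le p.1 (le_iSup_of_le p.2 le_rfl))))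
  calc 1 = ∑' p : X × A, M.occ (π f).toPolicy 0 p.1 p.2 := (M.tsum_occ _ _).symm
    _ ≤ ∑' p : X × A, c * μ 0 p := ENNReal.tsum_le_tsum h1
    _ = c := by rw [ENNReal.tsum_mul_left, (μ 0).tsum_coe, mul_one]

/-- A nearly optimal covering distribution. -/
theorem MDP.exists_covering [NeZero H] (hF : F.Nonempty) :
    ∃ μ : Fin H → X × A → ℝ, (∀ h, HasSum (μ h) 1) ∧ ∀ f ∈ F, ∀ h p,
      (M.occ (π f).toPolicy h p.1 p.2).toReal ≤
        2 * (M.coverability F π).toReal * μ h p := by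
  have hC := M.coverability_ne_top π hF
  have hC1 := M.one_le_coverability π hF
  have hlt : M.coverability F π < 2 * M.coverability F π := by
    rw [two_mul]
    exact ENNReal.lt_add_right hC (zero_lt_one.trans_le hC1).ne'
  obtain ⟨μ, hμ⟩ := iInf_lt_iff.1 hlt
  refine ⟨fun h p => (μ h p).toReal, fun h => ?_, fun f hf h p => ?_⟩
  · have h2 := ENNReal.hasSum_toReal (f := fun p : X × A => μ h p) (μ h).tsum_coe_ne_top
    rwa [← ENNReal.tsum_toReal_eq fun p => (μ h).apply_ne_top p, (μ h).tsum_coe,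
      ENNReal.toReal_one] at h2
  · have h0 : densityRatio (M.occ (π f).toPolicy h p.1 p.2) (μ h p) ≤
        ⨆ f ∈ F, ⨆ (h : Fin H) (x : X) (a : A),
          densityRatio (M.occ (π f).toPolicy h x a) (μ h (x, a)) :=
      le_iSup₂_of_le f hf
        (le_iSup_of_le h (le_iSup_of_le p.1 (le_iSup_of_le p.2 le_rfl)))
    have h1 : M.occ (π f).toPolicy h p.1 p.2 ≤ 2 * M.coverability F π * μ h p :=
      le_mul_of_densityRatio_le ((μ h).apply_ne_top p)
        (ENNReal.mul_ne_top ENNReal.ofNat_ne_top hC) (h0.trans hμ.le)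
    have h3 := ENNReal.toReal_mono (ENNReal.mul_ne_top (ENNReal.mul_ne_top ENNReal.ofNat_ne_top hC)
      ((μ h).apply_ne_top p)) h1
    simpa [ENNReal.toReal_mul] using h3

end Coverability

/-! ### Regret decomposition -/

section Regret

variable {X A : Type*} {H : ℕ} [MeasurableSpace X] [MeasurableSpace A]
  [Countable X] [DiscreteMeasurableSpace X] [Countable A] [DiscreteMeasurableSpace A]
  (M : MDP X A H)

/-- The value `𝔼[f_1(x_1, d_1(x_1))]` that `f` predicts for the policy `d`. -/
noncomputable def MDP.predictedValue [NeZero H] (f : ValueFn X A H) (d : DetPolicy X A H) : ℝ :=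
  ∫ x, f 0 x (d 0 x) ∂M.d₁.toMeasure

theorem sum_residual_eq [NeZero H] {f : ValueFn X A H} {d : DetPolicy X A H}
    (hd : ∀ h x a, f h x a ≤ f h x (d h x)) {τ : Traj X A H}
    (hτ : ∀ i, (τ i).2.1 = d i (τ i).1) :
    ∑ h, residual f h τ = f 0 (τ 0).1 (d 0 (τ 0).1) - ∑ h, (τ h).2.2 := by
  set v : ℕ → ℝ := fun k =>
    if hk : k < H then f ⟨k, hk⟩ (τ ⟨k, hk⟩).1 (d ⟨k, hk⟩ (τ ⟨k, hk⟩).1) else 0 with hv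
  have h1 : ∀ h : Fin H, residual f h τ = (v h - v (h + 1)) - (τ h).2.2 := by
    intro h
    have h2 : nextVal (stateValue f (h + 1)) h τ = v (h + 1) := by
      simp only [nextVal, hv]
      split_ifs with hh
      · exact stateValue_of_greedy hd ⟨h + 1, hh⟩ _
      · rfl
    have h3 : v h = f h (τ h).1 (τ h).2.1 := by
      rw [hτ]
      simp only [hv, dif_pos h.2]
    rw [residual_eq, h2, h3]
    ring
  simp only [h1]
  rw [Finset.sum_sub_distrib, Fin.sum_univ_eq_sum_range (fun k => v k - v (k + 1)),
    Finset.sum_range_sub']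
  simp only [hv, lt_irrefl, dif_neg, not_false_eq_true, sub_zero, dif_pos (NeZero.pos H)]
  rfl

theorem measurable_initial [NeZero H] (f : ValueFn X A H) (d : DetPolicy X A H) :
    Measurable fun τ : Traj X A H => f 0 (τ 0).1 (d 0 (τ 0).1) :=
  (Measurable.of_discrete (f := fun x => f 0 x (d 0 x))).comp
    (f := fun τ : Traj X A H => (τ 0).1) (by fun_prop)

theorem integral_initial [NeZero H] (f : ValueFn X A H) (d : DetPolicy X A H)
    (π : Policy X A H) :
    ∫ τ, f 0 (τ 0).1 (d 0 (τ 0).1) ∂M.trajLaw π = M.predictedValue f d := by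
  rw [MDP.predictedValue, ← M.map_trajLaw_first π,
    integral_map (Measurable.aemeasurable (by fun_prop))
    (Measurable.of_discrete (f := fun x => f 0 x (d 0 x))).aestronglyMeasurable]

/-- The gap between the value that `f` predicts for its greedy policy and the true value of this
policy is the sum of the Bellman errors that the policy encounters. -/
theorem predictedValue_sub_J [NeZero H] {f : ValueFn X A H} {d : DetPolicy X A H}
    (hf : ∀ h x a, f h x a ∈ Set.Icc (0 : ℝ) 1)
    (hd : ∀ h x a, f h x a ≤ f h x (d h x)) :
    M.predictedValue f d - M.J d.toPolicy =
      ∑ h, ∫ p, M.bellmanError f h p ∂M.occMeasure d.toPolicy h := by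
  have h1 : ∀ h, ∫ p, M.bellmanError f h p ∂M.occMeasure d.toPolicy h =
      ∫ τ, residual f h τ ∂M.trajLaw d.toPolicy := by
    intro h
    have := integral_residual_mul M hf d.toPolicy h (u := fun _ => 1) (B := 1) (by simp)
    simpa using this.symm
  have hi : ∀ h, Integrable (fun τ => residual f h τ) (M.trajLaw d.toPolicy) := by
    intro h
    refine Integrable.of_bound (measurable_residual f h).aestronglyMeasurable 2 ?_
    filter_upwards [M.ae_reward_mem d.toPolicy] with τ hτ using abs_residual_le hf (hτ h)
  simp only [h1]
  rw [← integral_finsetSum _ fun h _ => hi h, ← integral_initial M f d d.toPolicy, MDP.J,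
    ← integral_sub]
  · refine integral_congr_ae ?_
    filter_upwards [M.ae_action_eq d] with τ hτ using (sum_residual_eq hd hτ).symm
  · refine Integrable.of_bound (measurable_initial f d).aestronglyMeasurable 1
      (ae_of_all _ fun τ => ?_)
    rw [Real.norm_eq_abs, abs_of_nonneg (hf _ _ _).1]
    exact (hf _ _ _).2
  · refine Integrable.of_bound (Measurable.aestronglyMeasurable (by fun_prop)) H ?_
    filter_upwards [M.ae_reward_mem d.toPolicy] with τ hτ
    rw [Real.norm_eq_abs, abs_of_nonneg (Finset.sum_nonneg fun i _ => (hτ i).1)]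
    simpa using Finset.sum_le_card_nsmul Finset.univ (fun i => (τ i).2.2) 1 fun i _ => (hτ i).2

variable {M} in
theorem J_star_eq [NeZero H] {dstar d : DetPolicy X A H} (hopt : M.IsOptimal dstar.toPolicy)
    (hd : ∀ h x a, M.Q dstar.toPolicy h x a ≤ M.Q dstar.toPolicy h x (d h x)) :
    M.J dstar.toPolicy = M.predictedValue (M.Q dstar.toPolicy) d := by
  rw [MDP.J_eq_integral_V, MDP.predictedValue]
  refine integral_congr_ae (ae_of_all _ fun x => ?_)
  have h1 := MDP.stateValue_Q hopt ((0 : Fin H) : ℕ) x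
  rw [stateValue_of_greedy hd, dif_pos (0 : Fin H).2] at h1
  exact h1.symm

variable {M} in
theorem bellmanError_Q {dstar : DetPolicy X A H} (hopt : M.IsOptimal dstar.toPolicy)
    (h : Fin H) (p : X × A) : M.bellmanError (M.Q dstar.toPolicy) h p = 0 := by
  rw [MDP.bellmanError, MDP.Q_eq_backup hopt, sub_self]

theorem predictedValue_le_one [NeZero H] {f : ValueFn X A H} (d : DetPolicy X A H)
    (hf : ∀ h x a, f h x a ∈ Set.Icc (0 : ℝ) 1) : M.predictedValue f d ≤ 1 := by
  have h : ‖∫ x, f 0 x (d 0 x) ∂M.d₁.toMeasure‖ ≤ 1 * M.d₁.toMeasure.real Set.univ :=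
    norm_integral_le_of_norm_le_const (ae_of_all _ fun x => by
      rw [Real.norm_eq_abs, abs_of_nonneg (hf _ _ _).1]
      exact (hf _ _ _).2)
  rw [probReal_univ, mul_one] at h
  exact (le_abs_self _).trans h

end Regret

/-! ### Deviations of the empirical averages -/

section Deviations

variable {X A : Type*} {H : ℕ}

/-- The empirical quantity that is constrained by the confidence sets, for the clipping
level `G`. -/
noncomputable def penalizedResidual (f : ValueFn X A H) (w : WeightFn X A H) (G : ℝ) (h : Fin H)
    (τ : Traj X A H) : ℝ :=
  residual f h τ * clip (w h (τ h).1 (τ h).2.1) G - 8 / G * clip (w h (τ h).1 (τ h).2.1) G ^ 2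

variable [MeasurableSpace X] [MeasurableSpace A]

/-- The compensated increment of `Z` for the scale `l`. -/
noncomputable def bernsteinIncrement (M : MDP X A H) (π : Policy X A H) (Z : Traj X A H → ℝ)
    (l : ℝ) (τ : Traj X A H) : ℝ :=
  l * ∫ τ, Z τ ∂M.trajLaw π - l * Z τ - l ^ 2 * ∫ τ, Z τ ^ 2 ∂M.trajLaw π

/-- The increments of all the supermartingales that have to be controlled in one round:
residuals of the optimal value function `g`, penalized residuals of all candidates, and, in both
directions, the predicted values of all candidates. The scales `1 / (2 G)`, `1 / (10 G)` and `l ≤ 1`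
keep the scaled variables in `[-1, 1]`. -/
noncomputable def deviation [NeZero H] (M : MDP X A H) (F : Finset (ValueFn X A H))
    (W : Finset (WeightFn X A H)) (π : ValueFn X A H → DetPolicy X A H) (g : ValueFn X A H)
    (G l : ℝ) : (Fin H × W) ⊕ (Fin H × W × F) ⊕ (F × Bool) → ValueFn X A H → Traj X A H → ℝ
  | .inl (h, w) => fun _ τ =>
      1 / (2 * G) * (residual g h τ * clip (w.1 h (τ h).1 (τ h).2.1) G) -
        4 * (1 / (2 * G)) ^ 2 * clip (w.1 h (τ h).1 (τ h).2.1) G ^ 2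
  | .inr (.inl (h, w, f)) => fun f' =>
      bernsteinIncrement M (π f').toPolicy (penalizedResidual f.1 w.1 G h) (1 / (10 * G))
  | .inr (.inr (f, b)) => fun f' =>
      bernsteinIncrement M (π f').toPolicy (fun τ => f.1 0 (τ 0).1 (π f.1 0 (τ 0).1))
        (if b then l else -l)

variable [Countable X] [DiscreteMeasurableSpace X] [Countable A] [DiscreteMeasurableSpace A]

theorem measurable_clip_weight (w : WeightFn X A H) (G : ℝ) (h : Fin H) :
    Measurable fun τ : Traj X A H => clip (w h (τ h).1 (τ h).2.1) G :=
  (Measurable.of_discrete (f := fun p : X × A => clip (w h p.1 p.2) G)).comp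
    (f := fun τ : Traj X A H => ((τ h).1, (τ h).2.1)) (by fun_prop)

theorem measurable_penalizedResidual (f : ValueFn X A H) (w : WeightFn X A H) (G : ℝ)
    (h : Fin H) : Measurable (penalizedResidual f w G h) := by
  have h1 := measurable_residual f h
  have h2 := measurable_clip_weight w G h
  unfold penalizedResidual
  fun_prop

theorem abs_penalizedResidual_le {f : ValueFn X A H} (hf : ∀ h x a, f h x a ∈ Set.Icc (0 : ℝ) 1)
    (w : WeightFn X A H) {G : ℝ} (hG : 0 < G) {h : Fin H} {τ : Traj X A H}
    (hτ : (τ h).2.2 ∈ Set.Icc (0 : ℝ) 1) :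
    |penalizedResidual f w G h τ| ≤ 10 * clip (w h (τ h).1 (τ h).2.1) G := by
  have h1 := abs_residual_le hf hτ
  have h2 := clip_nonneg (w h (τ h).1 (τ h).2.1) G
  have h3 := clip_le (w h (τ h).1 (τ h).2.1) hG.le
  unfold penalizedResidual
  set c := clip (w h (τ h).1 (τ h).2.1) G
  have h4 : 8 / G * c ^ 2 ≤ 8 * c := by
    rw [div_mul_eq_mul_div, div_le_iff₀ hG]
    nlinarith
  have h5 : 0 ≤ 8 / G * c ^ 2 := by positivity
  have h6 := abs_sub (residual f h τ * c) (8 / G * c ^ 2)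
  rw [abs_mul, abs_of_nonneg h2, abs_of_nonneg h5] at h6
  have h7 := mul_le_mul_of_nonneg_right h1 h2
  linarith

variable (M : MDP X A H) {F : Finset (ValueFn X A H)} {W : Finset (WeightFn X A H)}
  {π : ValueFn X A H → DetPolicy X A H} {g : ValueFn X A H}

theorem measurable_deviation [NeZero H] (G l : ℝ)
    (j : (Fin H × W) ⊕ (Fin H × W × F) ⊕ (F × Bool)) (f' : ValueFn X A H) :
    Measurable (deviation M F W π g G l j f') := by
  rcases j with ⟨h, w⟩ | ⟨h, w, f⟩ | ⟨f, b⟩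
  · have h1 := measurable_residual g h
    have h2 := measurable_clip_weight w.1 G h
    simp only [deviation]
    fun_prop
  · have h1 := measurable_penalizedResidual f.1 w.1 G h
    simp only [deviation]
    unfold bernsteinIncrement
    fun_prop
  · have h1 := measurable_initial f.1 (π f.1)
    simp only [deviation]
    unfold bernsteinIncrement
    fun_prop

theorem lintegral_exp_deviation_le_one [NeZero H]
    (hF : ∀ f ∈ F, ∀ h x a, f h x a ∈ Set.Icc (0 : ℝ) 1)
    (hg : g ∈ F) (hbell : ∀ h p, M.bellmanError g h p = 0) {G l : ℝ} (hG : 0 < G) (hl0 : 0 ≤ l)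
    (hl1 : l ≤ 1) (j : (Fin H × W) ⊕ (Fin H × W × F) ⊕ (F × Bool)) (f' : ValueFn X A H) :
    ∫⁻ τ, ENNReal.ofReal (Real.exp (deviation M F W π g G l j f' τ))
      ∂M.trajLaw (π f').toPolicy ≤ 1 := by
  rcases j with ⟨h, w⟩ | ⟨h, w, f⟩ | ⟨f, b⟩
  · refine lintegral_exp_residual_le_one M (hF g hg) (π f').toPolicy h (hbell h)
      (u := fun p => clip (w.1 h p.1 p.2) G) (l := 1 / (2 * G)) (B := G) (by positivity)
      (fun p => ?_) (le_of_eq (by field_simp))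
    rw [abs_of_nonneg (clip_nonneg _ _)]
    exact clip_le _ hG.le
  · refine lintegral_exp_bernstein (measurable_penalizedResidual f.1 w.1 G h) (b := 10 * G) ?_ _ ?_
    · filter_upwards [M.ae_reward_mem (π f').toPolicy] with τ hτ
      have h1 := abs_penalizedResidual_le (hF f.1 f.2) w.1 hG (hτ h)
      have h2 := clip_le (w.1 h (τ h).1 (τ h).2.1) hG.le
      linarith
    · rw [abs_of_nonneg (by positivity)]
      exact le_of_eq (by field_simp)
  · refine lintegral_exp_bernstein (measurable_initial f.1 (π f.1)) (b := 1)
      (ae_of_all _ fun τ => ?_) _ ?_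
    · rw [abs_of_nonneg (hF f.1 f.2 _ _ _).1]
      exact (hF f.1 f.2 _ _ _).2
    · split_ifs
      · rwa [abs_of_nonneg hl0, mul_one]
      · rwa [abs_neg, abs_of_nonneg hl0, mul_one]

/-- Union bound over all rounds and all deviations. -/
theorem runLaw_exists_deviation_ge_le [NeZero H]
    (hF : ∀ f ∈ F, ∀ h x a, f h x a ∈ Set.Icc (0 : ℝ) 1)
    (hg : g ∈ F) (hbell : ∀ h p, M.bellmanError g h p = 0) {G : ℕ → ℝ} (hG : ∀ n, 0 < G n)
    {l : ℝ} (hl0 : 0 ≤ l) (hl1 : l ≤ 1) {rule : (n : ℕ) → Data X A H 1 n → ValueFn X A H}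
    (hmem : ∀ n D, rule n D ∈ F) (hmeas : ∀ n f, MeasurableSet {D | rule n D = f})
    (T : ℕ) (s : ℝ) :
    runLaw M π rule T {D | ∃ q : Fin T × ((Fin H × W) ⊕ (Fin H × W × F) ⊕ (F × Bool)),
      s ≤ ∑ i : Fin q.1, deviation M F W π g (G q.1) l q.2
        (selected rule D (Fin.castLE q.1.isLt.le i)) (D (Fin.castLE q.1.isLt.le i) 0)} ≤
    (T * (H * W.card + (H * (W.card * F.card) + F.card * 2)) : ℕ) *
      ENNReal.ofReal (Real.exp (-s)) := by
  rw [Set.ofPred_exists]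
  refine (measure_iUnion_fintype_le _ _).trans ?_
  calc _ ≤ ∑ _q : Fin T × ((Fin H × W) ⊕ (Fin H × W × F) ⊕ (F × Bool)),
        ENNReal.ofReal (Real.exp (-s)) :=
        Finset.sum_le_sum fun q _ => runLaw_sum_ge_le M F π q.1.isLt.le hmem hmeas
          (deviation M F W π g (G q.1) l q.2) (measurable_deviation M _ _ _)
          (fun f _ => lintegral_exp_deviation_le_one M hF hg hbell (hG _) hl0 hl1 _ f) s
    _ = _ := by
        rw [Finset.sum_const, nsmul_eq_mul, Finset.card_univ]
        simp only [Fintype.card_prod, Fintype.card_sum, Fintype.card_fin, Fintype.card_coe,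
          Fintype.card_bool]

end Deviations

/-! ### The regret in the absence of deviations -/

section Rounds

variable {X A : Type*} {H : ℕ} [MeasurableSpace X] [MeasurableSpace A]
  [Countable X] [DiscreteMeasurableSpace X] [Countable A] [DiscreteMeasurableSpace A]
  (M : MDP X A H)

theorem MDP.hasSum_occ_mul (π : Policy X A H) (h : Fin H) {u : X × A → ℝ} {B : ℝ}
    (hu : ∀ p, |u p| ≤ B) :
    HasSum (fun p : X × A => (M.occ π h p.1 p.2).toReal * u p) (∫ p, u p ∂M.occMeasure π h) := by
  rw [M.integral_occMeasure π h hu]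
  refine Summable.hasSum (Summable.of_norm_bounded
    ((M.hasSum_occ_toReal π h).summable.mul_right B) fun p => ?_)
  rw [Real.norm_eq_abs, abs_mul, abs_of_nonneg ENNReal.toReal_nonneg]
  exact mul_le_mul_of_nonneg_left (hu p) ENNReal.toReal_nonneg

theorem summable_potential (π : Policy X A H) (h : Fin H) (γ : ℝ) (S : X × A → ℝ) :
    Summable fun p : X × A => potential γ (M.occ π h p.1 p.2).toReal (S p) :=
  Summable.of_nonneg_of_le (fun _ => potential_nonneg ENNReal.toReal_nonneg)
    (fun _ => potential_le ENNReal.toReal_nonneg) (M.hasSum_occ_toReal π h).summable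

theorem MDP.mixOcc_toReal {n : ℕ} (ρ : Fin n → Policy X A H) (h : Fin H) (x : X) (a : A) :
    (M.mixOcc ρ h x a).toReal = (∑ i, (M.occ (ρ i) h x a).toReal) / n := by
  rw [mixOcc, ENNReal.toReal_div, ENNReal.toReal_sum fun i _ => M.occ_ne_top _ _ _ _,
    ENNReal.toReal_natCast]

/-- First two moments of the penalized residual, in terms of the Bellman error. -/
theorem penalizedResidual_moments {f : ValueFn X A H}
    (hf : ∀ h x a, f h x a ∈ Set.Icc (0 : ℝ) 1) (w : WeightFn X A H) {G : ℝ} (hG : 0 < G)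
    (h : Fin H) (ρ : Policy X A H) :
    ∫ τ, penalizedResidual f w G h τ ∂M.trajLaw ρ =
      ∫ p, M.bellmanError f h p * clip (w h p.1 p.2) G ∂M.occMeasure ρ h -
        8 / G * ∫ p, clip (w h p.1 p.2) G ^ 2 ∂M.occMeasure ρ h ∧
    ∫ τ, penalizedResidual f w G h τ ^ 2 ∂M.trajLaw ρ ≤
      100 * ∫ p, clip (w h p.1 p.2) G ^ 2 ∂M.occMeasure ρ h := by
  set ω : X × A → ℝ := fun p => clip (w h p.1 p.2) G with hω
  have hωG : ∀ p, |ω p| ≤ G := fun p => by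
    rw [abs_of_nonneg (clip_nonneg _ _)]
    exact clip_le _ hG.le
  have hmeas := measurable_penalizedResidual f w G h
  have hωm : Measurable fun τ : Traj X A H => ω ((τ h).1, (τ h).2.1) :=
    measurable_clip_weight w G h
  have hsq : ∫ p, ω p ^ 2 ∂M.occMeasure ρ h =
      ∫ τ, ω ((τ h).1, (τ h).2.1) ^ 2 ∂M.trajLaw ρ := by
    rw [MDP.occMeasure, integral_map (Measurable.aemeasurable (by fun_prop))
      (Measurable.of_discrete (f := fun p => ω p ^ 2)).aestronglyMeasurable]
  have hsqi : Integrable (fun τ : Traj X A H => ω ((τ h).1, (τ h).2.1) ^ 2) (M.trajLaw ρ) := by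
    refine Integrable.of_bound (hωm.pow_const 2).aestronglyMeasurable (G ^ 2)
      (ae_of_all _ fun τ => ?_)
    rw [Real.norm_eq_abs, abs_pow]
    exact pow_le_pow_left₀ (abs_nonneg _) (hωG _) 2
  rw [hsq]
  constructor
  · have hri : Integrable (fun τ : Traj X A H => residual f h τ * ω ((τ h).1, (τ h).2.1))
        (M.trajLaw ρ) := by
      refine Integrable.of_bound ((measurable_residual f h).mul hωm).aestronglyMeasurable
        (2 * G) ?_
      filter_upwards [M.ae_reward_mem ρ] with τ hτ
      rw [Real.norm_eq_abs, abs_mul]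
      exact mul_le_mul (abs_residual_le hf (hτ h)) (hωG _) (abs_nonneg _) zero_le_two
    rw [← integral_residual_mul M hf ρ h hωG, ← integral_const_mul,
      ← integral_sub hri (hsqi.const_mul _)]
    rfl
  · rw [← integral_const_mul]
    have hle : ∀ᵐ τ ∂M.trajLaw ρ, penalizedResidual f w G h τ ^ 2 ≤
        100 * ω ((τ h).1, (τ h).2.1) ^ 2 := by
      filter_upwards [M.ae_reward_mem ρ] with τ hτ
      have h1 := abs_penalizedResidual_le hf w hG (hτ h)
      calc penalizedResidual f w G h τ ^ 2 = |penalizedResidual f w G h τ| ^ 2 := (sq_abs _).symm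
        _ ≤ (10 * ω ((τ h).1, (τ h).2.1)) ^ 2 := pow_le_pow_left₀ (abs_nonneg _) h1 2
        _ = _ := by ring
    refine integral_mono_ae (Integrable.mono' (hsqi.const_mul 100)
      (hmeas.pow_const 2).aestronglyMeasurable ?_) (hsqi.const_mul 100) hle
    filter_upwards [hle] with τ hτ
    rwa [Real.norm_eq_abs, abs_of_nonneg (sq_nonneg _)]

/-- A function that satisfies the empirical constraint has a small Bellman error under a policy
whose density ratio with respect to the past data is one of the weights, up to the potential of
the pair. -/
theorem integral_bellmanError_le {f : ValueFn X A H}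
    (hf : ∀ h x a, f h x a ∈ Set.Icc (0 : ℝ) 1) {n : ℕ} (hn : 0 < n) {q : Policy X A H}
    {ρ : Fin n → Policy X A H} {D : Fin n → Traj X A H} {w : WeightFn X A H} {h : Fin H}
    (hw : ∀ x a, w h x a = densityRatio (M.occ q h x a) (M.mixOcc ρ h x a)) {γ s G : ℝ}
    (hγ : 0 < γ) (hs : 0 ≤ s) (hG : G = γ * (n + 1))
    (hconf : ∑ i, penalizedResidual f w G h (D i) ≤ 36 * G * s)
    (hdev : ∑ i, bernsteinIncrement M (ρ i) (penalizedResidual f w G h) (1 / (10 * G)) (D i) ≤ s) :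
    ∫ p, M.bellmanError f h p ∂M.occMeasure q h ≤
      92 * γ * s + 21 * ∑' p : X × A, potential γ (M.occ q h p.1 p.2).toReal
        (∑ i, (M.occ (ρ i) h p.1 p.2).toReal) := by
  have hn' : (0 : ℝ) < n := Nat.cast_pos.2 hn
  have hGpos : 0 < G := by rw [hG]; positivity
  set ω : X × A → ℝ := fun p => clip (w h p.1 p.2) G with hω
  set d : X × A → ℝ := fun p => (M.occ q h p.1 p.2).toReal with hd
  set S : X × A → ℝ := fun p => ∑ i, (M.occ (ρ i) h p.1 p.2).toReal with hS
  set e : Fin n → ℝ := fun i => ∫ p, M.bellmanError f h p * ω p ∂M.occMeasure (ρ i) h with he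
  set m : Fin n → ℝ := fun i => ∫ p, ω p ^ 2 ∂M.occMeasure (ρ i) h with hm
  have hω0 : ∀ p, 0 ≤ ω p := fun p => clip_nonneg _ _
  have hωG : ∀ p, ω p ≤ G := fun p => clip_le _ hGpos.le
  have hωb : ∀ p, |ω p| ≤ G := fun p => by rw [abs_of_nonneg (hω0 p)]; exact hωG p
  have hε := abs_bellmanError_le M hf h
  -- the empirical constraint controls the expected residuals
  have h1 : ∑ i, e i ≤ 46 * G * s + 18 / G * ∑ i, m i := by
    have h2 : ∀ i, (1 / (10 * G)) * (e i - 8 / G * m i) -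
        (1 / (10 * G)) * penalizedResidual f w G h (D i) - (1 / (10 * G)) ^ 2 * (100 * m i) ≤
        bernsteinIncrement M (ρ i) (penalizedResidual f w G h) (1 / (10 * G)) (D i) := by
      intro i
      obtain ⟨h3, h4⟩ := penalizedResidual_moments M hf w hGpos h (ρ i)
      rw [bernsteinIncrement, h3]
      have := mul_le_mul_of_nonneg_left h4 (sq_nonneg (1 / (10 * G)))
      simp only [he, hm, hω]
      linarith
    have h5 := (Finset.sum_le_sum fun i (_ : i ∈ Finset.univ) => h2 i).trans hdev
    simp only [Finset.sum_sub_distrib, ← Finset.mul_sum] at h5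
    set E := ∑ i, e i
    set m' := ∑ i, m i
    set Z := ∑ i, penalizedResidual f w G h (D i)
    have h6 : (1 / (10 * G)) * (E - 8 / G * m') - (1 / (10 * G)) * Z -
        (1 / (10 * G)) ^ 2 * (100 * m') = (E - 18 / G * m' - Z) / (10 * G) := by
      field_simp
      ring
    rw [h6, div_le_iff₀ (by positivity)] at h5
    linarith
  have hbd : ∀ p, 0 ≤ d p - S p * ω p / n ∧ d p - S p * ω p / n ≤ potential γ (d p) (S p) ∧
      S p * ω p ^ 2 / n / G ≤ potential γ (d p) (S p) := by
    intro p
    refine clipped_ratio_bounds hγ hn' ENNReal.toReal_nonneg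
      (Finset.sum_nonneg fun i _ => ENNReal.toReal_nonneg) hG (hω0 p) (hωG p) fun hSp => ?_
    have h2 := M.mixOcc_toReal ρ h p.1 p.2
    have h3 : M.mixOcc ρ h p.1 p.2 ≠ 0 := by
      intro h0
      rw [h0, ENNReal.toReal_zero] at h2
      exact hSp ((div_eq_zero_iff.1 h2.symm).resolve_right hn'.ne')
    simp only [hω, hw]
    rw [clip_densityRatio (M.occ_ne_top _ _ _ _) h3 hGpos.le, h2]
  have hP := (summable_potential M q h γ S).hasSum
  have hsumE : HasSum (fun p => S p * (M.bellmanError f h p * ω p)) (∑ i, e i) := by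
    simp only [hS, Finset.sum_mul]
    refine hasSum_sum fun i _ => M.hasSum_occ_mul (ρ i) h (B := 3 * G) fun p => ?_
    rw [abs_mul]
    exact mul_le_mul (hε p) (hωb p) (abs_nonneg _) (by norm_num)
  have hsumM : HasSum (fun p => S p * ω p ^ 2) (∑ i, m i) := by
    simp only [hS, Finset.sum_mul]
    refine hasSum_sum fun i _ => M.hasSum_occ_mul (ρ i) h (B := G ^ 2) fun p => ?_
    rw [abs_pow]
    exact pow_le_pow_left₀ (abs_nonneg _) (hωb p) 2
  have h7 := hasSum_le (fun p => (hbd p).2.2) ((hsumM.div_const n).div_const G) hP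
  have h8 : ∫ p, M.bellmanError f h p ∂M.occMeasure q h - (∑ i, e i) / n ≤
      3 * ∑' p, potential γ (d p) (S p) := by
    refine hasSum_le (fun p => ?_) ((M.hasSum_occ_mul q h hε).sub (hsumE.div_const n))
      (hP.mul_left 3)
    calc d p * M.bellmanError f h p - S p * (M.bellmanError f h p * ω p) / n
        = M.bellmanError f h p * (d p - S p * ω p / n) := by ring
      _ ≤ 3 * (d p - S p * ω p / n) :=
          mul_le_mul_of_nonneg_right ((le_abs_self _).trans (hε p)) (hbd p).1
      _ ≤ _ := by linarith [(hbd p).2.1]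
  have h9 : (∑ i, e i) / n ≤ 92 * γ * s + 18 * ((∑ i, m i) / n / G) := by
    rw [div_le_iff₀ hn']
    have h10 : G ≤ 2 * γ * n := by
      rw [hG]
      have : (1 : ℝ) ≤ n := by exact_mod_cast hn
      nlinarith
    calc _ ≤ 46 * G * s + 18 / G * ∑ i, m i := h1
      _ ≤ 46 * (2 * γ * n) * s + 18 / G * ∑ i, m i := by gcongr
      _ = _ := by field_simp; ring
  linarith

variable {M} {F : Finset (ValueFn X A H)} {W : Finset (WeightFn X A H)}
  {π : ValueFn X A H → DetPolicy X A H}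

theorem empMean_one {n : ℕ} (D : Data X A H 1 n) (φ : Traj X A H → ℝ) :
    empMean D φ = (∑ i, φ (D i 0)) / n := by
  simp [empMean]

/-- The constraint of the confidence set in terms of sums. -/
theorem sum_le_of_mem_confidenceSet {T : ℕ} {γ δ : ℝ} {n : ℕ} (hn : 0 < n)
    {D : Data X A H 1 n} {f : ValueFn X A H} (hf : f ∈ confidenceSet ⟨T, 1, γ, δ⟩ F W D)
    (h : Fin H) {w : WeightFn X A H} (hw : w ∈ W) :
    ∑ i, penalizedResidual f w (γ * (n + 1)) h (D i 0) ≤ 36 * (γ * (n + 1)) *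
      Real.log (6 * (F.card : ℝ) * (W.card : ℝ) * T * H / δ) := by
  have hn' : (0 : ℝ) < n := Nat.cast_pos.2 hn
  have h1 := hf.2 h w hw
  rw [empMean_one, div_le_iff₀ hn'] at h1
  refine h1.trans (le_of_eq ?_)
  simp only [Params.β, Params.clipLevel, Nat.cast_one, one_mul]
  field_simp

/-- In the absence of deviations, the function `g` satisfies all constraints. -/
theorem mem_confidenceSet_of_deviation_le [NeZero H] {T : ℕ} {γ δ l : ℝ} (hγ : 0 < γ) {n : ℕ}
    {D : Data X A H 1 n} {g : ValueFn X A H} (hg : g ∈ F) {f' : Fin n → ValueFn X A H}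
    (hs : 0 ≤ Real.log (6 * (F.card : ℝ) * (W.card : ℝ) * T * H / δ))
    (hdev : ∀ j, ∑ i, deviation M F W π g (γ * (n + 1)) l j (f' i) (D i 0) ≤
      Real.log (6 * (F.card : ℝ) * (W.card : ℝ) * T * H / δ)) :
    g ∈ confidenceSet ⟨T, 1, γ, δ⟩ F W D := by
  rcases n.eq_zero_or_pos with rfl | hn
  · rw [confidenceSet_zero]
    exact hg
  have hn' : (0 : ℝ) < n := Nat.cast_pos.2 hn
  refine ⟨hg, fun h w hw => ?_⟩
  rw [empMean_one, div_le_iff₀ hn']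
  have h1 := hdev (.inl (h, ⟨w, hw⟩))
  simp only [deviation] at h1
  simp only [Params.β, Params.α, Params.clipLevel, Nat.cast_one, one_mul]
  set s := Real.log (6 * (F.card : ℝ) * (W.card : ℝ) * T * H / δ)
  set G := γ * ((n : ℝ) + 1) with hG
  have hGpos : 0 < G := by positivity
  have h2 : ∀ i, residual g h (D i 0) * clip (w h (D i 0 h).1 (D i 0 h).2.1) G -
      8 / G * clip (w h (D i 0 h).1 (D i 0 h).2.1) G ^ 2 ≤
      2 * G * (1 / (2 * G) * (residual g h (D i 0) * clip (w h (D i 0 h).1 (D i 0 h).2.1) G) -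
        4 * (1 / (2 * G)) ^ 2 * clip (w h (D i 0 h).1 (D i 0 h).2.1) G ^ 2) := by
    intro i
    set c := clip (w h (D i 0 h).1 (D i 0 h).2.1) G
    have h3 : 2 * G * (1 / (2 * G) * (residual g h (D i 0) * c) -
        4 * (1 / (2 * G)) ^ 2 * c ^ 2) = residual g h (D i 0) * c - 2 / G * c ^ 2 := by
      field_simp
      ring
    rw [h3]
    have : 2 / G * c ^ 2 ≤ 8 / G * c ^ 2 := by gcongr; norm_num
    linarith
  calc _ ≤ ∑ i, 2 * G * (1 / (2 * G) *
        (residual g h (D i 0) * clip (w h (D i 0 h).1 (D i 0 h).2.1) G) -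
        4 * (1 / (2 * G)) ^ 2 * clip (w h (D i 0 h).1 (D i 0 h).2.1) G ^ 2) :=
        Finset.sum_le_sum fun i _ => h2 i
    _ ≤ 2 * G * s := by
        rw [← Finset.mul_sum]
        exact mul_le_mul_of_nonneg_left h1 (by positivity)
    _ ≤ 36 * G * s := by nlinarith [mul_nonneg hGpos.le hs]
    _ = _ := by field_simp

/-- In the absence of deviations, the empirical initial values are close to the predicted
values. -/
theorem abs_predictedValue_sub_le [NeZero H]
    (hF : ∀ f ∈ F, ∀ h x a, f h x a ∈ Set.Icc (0 : ℝ) 1) {n : ℕ} (hn : 0 < n)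
    {D : Data X A H 1 n} {g : ValueFn X A H} {f' : Fin n → ValueFn X A H} {G l s : ℝ} (hl : 0 < l)
    (hdev : ∀ j, ∑ i, deviation M F W π g G l j (f' i) (D i 0) ≤ s) {f : ValueFn X A H}
    (hf : f ∈ F) :
    |M.predictedValue f (π f) - optimisticValue π D f| ≤ s / (n * l) + l := by
  have hn' : (0 : ℝ) < n := Nat.cast_pos.2 hn
  have hv : ∀ ρ : Policy X A H,
      ∫ τ, f 0 (τ 0).1 (π f 0 (τ 0).1) ∂M.trajLaw ρ = M.predictedValue f (π f) :=
    integral_initial M f (π f)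
  have hv2 : ∀ ρ : Policy X A H,
      ∫ τ, f 0 (τ 0).1 (π f 0 (τ 0).1) ^ 2 ∂M.trajLaw ρ ≤ 1 := by
    intro ρ
    have h : ‖∫ τ, f 0 (τ 0).1 (π f 0 (τ 0).1) ^ 2 ∂M.trajLaw ρ‖ ≤
        1 * (M.trajLaw ρ).real Set.univ :=
      norm_integral_le_of_norm_le_const (ae_of_all _ fun τ => by
        rw [Real.norm_eq_abs, abs_of_nonneg (sq_nonneg _)]
        exact pow_le_one₀ (hF f hf _ _ _).1 (hF f hf _ _ _).2)
    rw [probReal_univ, mul_one] at h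
    exact (le_abs_self _).trans h
  have key : ∀ b : Bool, (if b then l else -l) *
      (M.predictedValue f (π f) * n - ∑ i, f 0 (D i 0 0).1 (π f 0 (D i 0 0).1)) ≤
        s + l ^ 2 * n := by
    intro b
    have h1 := hdev (.inr (.inr (⟨f, hf⟩, b)))
    simp only [deviation, bernsteinIncrement, hv] at h1
    have hl2 : (if b then l else -l) ^ 2 = l ^ 2 := by split_ifs <;> ring
    rw [hl2] at h1
    simp only [Finset.sum_sub_distrib, ← Finset.mul_sum, Finset.sum_const, Finset.card_univ,
      Fintype.card_fin, nsmul_eq_mul] at h1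
    have h2 := Finset.sum_le_card_nsmul Finset.univ
      (fun i : Fin n => ∫ τ, f 0 (τ 0).1 (π f 0 (τ 0).1) ^ 2 ∂M.trajLaw (π (f' i)).toPolicy) 1
      fun i _ => hv2 _
    simp only [Finset.card_univ, Fintype.card_fin, nsmul_eq_mul, mul_one] at h2
    have h3 := mul_le_mul_of_nonneg_left h2 (sq_nonneg l)
    linarith
  have h1 := key true
  have h2 := key false
  simp only [if_true, Bool.false_eq_true, if_false] at h1 h2
  rw [optimisticValue, empMean_one]
  set Y := ∑ i, f 0 (D i 0 0).1 (π f 0 (D i 0 0).1)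
  set v := M.predictedValue f (π f)
  have h3 : l * n * (v - Y / n) = l * (v * n - Y) := by field_simp
  have h4 : l * n * (s / (n * l) + l) = s + l ^ 2 * n := by field_simp
  have h5 : 0 < l * n := by positivity
  rw [abs_le]
  constructor
  · refine le_of_mul_le_mul_left ?_ h5
    linarith
  · refine le_of_mul_le_mul_left ?_ h5
    linarith

theorem sum_inv_le (T : ℕ) : ∑ n ∈ Finset.range T, (n : ℝ)⁻¹ ≤ 1 + Real.log T := by
  cases T with
  | zero => simp
  | succ m =>
    rw [Finset.sum_range_succ']
    have h1 := harmonic_le_one_add_log m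
    simp only [harmonic, Rat.cast_sum, Rat.cast_inv, Rat.cast_natCast] at h1
    have h2 : Real.log m ≤ Real.log ((m + 1 : ℕ) : ℝ) := by
      rcases m.eq_zero_or_pos with rfl | hm
      · simp
      · exact Real.log_le_log (by exact_mod_cast hm) (by push_cast; linarith)
    simpa using h1.trans (add_le_add le_rfl h2)

end Rounds

section RegretBound

variable {X A : Type*} {H : ℕ} [NeZero H] [MeasurableSpace X] [MeasurableSpace A]
  [Countable X] [DiscreteMeasurableSpace X] [Countable A] [DiscreteMeasurableSpace A]
  {M : MDP X A H} {F : Finset (ValueFn X A H)} {W : Finset (WeightFn X A H)}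
  {π : ValueFn X A H → DetPolicy X A H} {dstar : DetPolicy X A H}

theorem J_gap_le_one (hopt : M.IsOptimal dstar.toPolicy)
    (hF : ∀ f ∈ F, ∀ h x a, f h x a ∈ Set.Icc (0 : ℝ) 1) (hπ : IsGreedy F π)
    (hQ : M.Q dstar.toPolicy ∈ F) (q : Policy X A H) : M.J dstar.toPolicy - M.J q ≤ 1 := by
  have h1 := predictedValue_le_one M (π (M.Q dstar.toPolicy)) (hF _ hQ)
  rw [← J_star_eq hopt (hπ _ hQ)] at h1
  linarith [M.J_nonneg q]

/-- A greedy policy of the optimal value function is optimal. -/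
theorem J_greedy_Q (hopt : M.IsOptimal dstar.toPolicy)
    (hF : ∀ f ∈ F, ∀ h x a, f h x a ∈ Set.Icc (0 : ℝ) 1) (hπ : IsGreedy F π)
    (hQ : M.Q dstar.toPolicy ∈ F) :
    M.J (π (M.Q dstar.toPolicy)).toPolicy = M.J dstar.toPolicy := by
  have h1 := predictedValue_sub_J M (hF _ hQ) (hπ _ hQ)
  rw [← J_star_eq hopt (hπ _ hQ)] at h1
  simp only [bellmanError_Q hopt, integral_zero, Finset.sum_const_zero] at h1
  linarith

/-- The suboptimality of the policy played in a round with data. The optimal value function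
satisfies the constraints, so that the selected function is optimistic. -/
theorem round_gap_le (hopt : M.IsOptimal dstar.toPolicy)
    (hF : ∀ f ∈ F, ∀ h x a, f h x a ∈ Set.Icc (0 : ℝ) 1) (hπ : IsGreedy F π)
    (hQ : M.Q dstar.toPolicy ∈ F) {T : ℕ} (hW : M.MixtureRealizable F W π T) {γ δ l s : ℝ}
    (hγ : 0 < γ) (hl : 0 < l) (hs : 0 ≤ s)
    (hsdef : s = Real.log (6 * (F.card : ℝ) * (W.card : ℝ) * T * H / δ))
    {rule : (n : ℕ) → Data X A H 1 n → ValueFn X A H}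
    (hrule : IsGlowRule ⟨T, 1, γ, δ⟩ F W π rule) {D : Data X A H 1 T} (t : Fin T)
    (ht : 0 < (t : ℕ))
    (hdev : ∀ j, ∑ i : Fin t, deviation M F W π (M.Q dstar.toPolicy) (γ * ((t : ℕ) + 1)) l j
      (selected rule D (Fin.castLE t.isLt.le i)) (D (Fin.castLE t.isLt.le i) 0) ≤ s) :
    M.J dstar.toPolicy - M.J (π (selected rule D t)).toPolicy ≤
      2 * (s / ((t : ℕ) * l) + l) + ∑ h, (92 * γ * s + 21 * ∑' p : X × A, potential γ
        (M.occ (π (selected rule D t)).toPolicy h p.1 p.2).toReal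
        (∑ i : Fin t, (M.occ (π (selected rule D (Fin.castLE t.isLt.le i))).toPolicy h
          p.1 p.2).toReal)) := by
  set g := M.Q dstar.toPolicy with hg
  set D' : Data X A H 1 t := fun i => D (Fin.castLE t.isLt.le i) with hD'
  set f := selected rule D t with hf
  have hfF : f ∈ F := hrule.mem _ _
  have hgconf : g ∈ confidenceSet ⟨T, 1, γ, δ⟩ F W D' :=
    mem_confidenceSet_of_deviation_le (M := M) (π := π) (l := l) hγ hQ
      (f' := fun i => selected rule D (Fin.castLE t.isLt.le i)) (hsdef ▸ hs)
      fun j => hsdef ▸ hdev j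
  have hfconf : f ∈ confidenceSet ⟨T, 1, γ, δ⟩ F W D' := hrule.mem_confidenceSet _ D' ⟨g, hgconf⟩
  have hmax : optimisticValue π D' g ≤ optimisticValue π D' f :=
    hrule.le_optimisticValue _ D' g hgconf
  have h1 := (abs_le.1 (abs_predictedValue_sub_le (D := D') hF ht hl hdev hQ)).2
  have h2 := (abs_le.1 (abs_predictedValue_sub_le (D := D') hF ht hl hdev hfF)).1
  have h3 := predictedValue_sub_J M (hF f hfF) (hπ f hfF)
  have h4 := J_star_eq hopt (hπ _ hQ)
  have h5 : ∑ h, ∫ p, M.bellmanError f h p ∂M.occMeasure (π f).toPolicy h ≤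
      ∑ h, (92 * γ * s + 21 * ∑' p : X × A, potential γ
        (M.occ (π f).toPolicy h p.1 p.2).toReal
        (∑ i : Fin t, (M.occ (π (selected rule D (Fin.castLE t.isLt.le i))).toPolicy h
          p.1 p.2).toReal)) := by
    refine Finset.sum_le_sum fun h _ => ?_
    obtain ⟨w, hwW, hw⟩ := hW h f hfF t ht t.isLt.le
      (fun i => selected rule D (Fin.castLE t.isLt.le i)) fun i => hrule.mem _ _
    refine integral_bellmanError_le M (hF f hfF) ht (D := fun i => D' i 0) hw hγ hs rfl ?_
      (hdev (.inr (.inl (h, ⟨w, hwW⟩, ⟨f, hfF⟩))))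
    rw [hsdef]
    exact sum_le_of_mem_confidenceSet ht hfconf h hwW
  linarith

/-- The regret bound on the event without deviations, before the choice of the parameters. -/
theorem regret_le_of_no_deviation (hopt : M.IsOptimal dstar.toPolicy)
    (hF : ∀ f ∈ F, ∀ h x a, f h x a ∈ Set.Icc (0 : ℝ) 1) (hπ : IsGreedy F π)
    (hQ : M.Q dstar.toPolicy ∈ F) {T : ℕ} (hW : M.MixtureRealizable F W π T) {γ δ l s : ℝ}
    (hγ : 0 < γ) (hl : 0 < l) (hs : 0 ≤ s)
    (hsdef : s = Real.log (6 * (F.card : ℝ) * (W.card : ℝ) * T * H / δ))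
    {rule : (n : ℕ) → Data X A H 1 n → ValueFn X A H}
    (hrule : IsGlowRule ⟨T, 1, γ, δ⟩ F W π rule) {D : Data X A H 1 T}
    (hdev : ∀ t : Fin T, ∀ j, ∑ i : Fin t, deviation M F W π (M.Q dstar.toPolicy)
      (γ * ((t : ℕ) + 1)) l j
      (selected rule D (Fin.castLE t.isLt.le i)) (D (Fin.castLE t.isLt.le i) 0) ≤ s) :
    M.regret dstar.toPolicy (playedPolicy π rule D) ≤
      1 + 2 * T * l + 2 * s / l * (1 + Real.log T) + 92 * H * T * γ * s +
        42 * H * (M.coverability F π).toReal * (2 + 4 / γ * Real.log (1 + T)) := by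
  set C := (M.coverability F π).toReal with hC
  obtain ⟨μ, hμ1, hμ⟩ := M.exists_covering π ⟨_, hQ⟩
  rw [← hC] at hμ
  -- the values of `fs` beyond the last round are irrelevant
  set fs : ℕ → ValueFn X A H := fun n =>
    if hn : n < T then selected rule D ⟨n, hn⟩ else M.Q dstar.toPolicy with hfs
  have hfsF : ∀ n, fs n ∈ F := by
    intro n
    simp only [hfs]
    split_ifs
    · exact hrule.mem _ _
    · exact hQ
  have hfst : ∀ t : Fin T, fs t = selected rule D t := fun t => by simp [hfs]
  set d : Fin H → X × A → ℕ → ℝ := fun h p n => (M.occ (π (fs n)).toPolicy h p.1 p.2).toReal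
    with hd
  set Ψ : Fin H → ℕ → ℝ := fun h n =>
    ∑' p : X × A, potential γ (d h p n) (∑ i ∈ Finset.range n, d h p i) with hΨ
  have hsummable : ∀ h n, Summable fun p : X × A =>
      potential γ (d h p n) (∑ i ∈ Finset.range n, d h p i) := fun h n =>
    summable_potential M (π (fs n)).toPolicy h γ fun p => ∑ i ∈ Finset.range n, d h p i
  have hΨ0 : ∀ h n, 0 ≤ Ψ h n := fun h n =>
    tsum_nonneg fun p => potential_nonneg ENNReal.toReal_nonneg
  have hgap : ∀ t : Fin T, M.J dstar.toPolicy - M.J (playedPolicy π rule D t) ≤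
      (if (t : ℕ) = 0 then 1 else 0) + 2 * l + 2 * s / l * ((t : ℕ) : ℝ)⁻¹ + 92 * H * γ * s +
        21 * ∑ h, Ψ h t := by
    intro t
    rcases Nat.eq_zero_or_pos t with ht | ht
    -- without data, the gap is at most `1`, and the third summand vanishes because of `0⁻¹ = 0`
    · have h1 := J_gap_le_one hopt hF hπ hQ (playedPolicy π rule D t)
      have h2 : 0 ≤ ∑ h, Ψ h t := Finset.sum_nonneg fun h _ => hΨ0 h t
      rw [if_pos ht, ht]
      rw [ht] at h2
      have h3 : 0 ≤ 92 * H * γ * s := by positivity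
      simp only [Nat.cast_zero, inv_zero, mul_zero]
      linarith
    · have h1 := round_gap_le hopt hF hπ hQ hW hγ hl hs hsdef hrule t ht (hdev t)
      have h2 : ∀ h, ∑' p : X × A, potential γ
          (M.occ (π (selected rule D t)).toPolicy h p.1 p.2).toReal
          (∑ i : Fin t, (M.occ (π (selected rule D (Fin.castLE t.isLt.le i))).toPolicy h
            p.1 p.2).toReal) = Ψ h t := by
        intro h
        refine tsum_congr fun p => ?_
        simp only [hd, hfst, ← Fin.sum_univ_eq_sum_range]
        congr 1
        refine Finset.sum_congr rfl fun i _ => ?_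
        rw [← hfst (Fin.castLE t.isLt.le i)]
        rfl
      simp only [h2, Finset.sum_add_distrib, ← Finset.mul_sum, Finset.sum_const,
        Finset.card_univ, Fintype.card_fin, nsmul_eq_mul] at h1
      rw [if_neg ht.ne']
      refine (h1.trans (le_of_eq ?_))
      have ht' : ((t : ℕ) : ℝ) ≠ 0 := by exact_mod_cast ht.ne'
      field_simp
      ring
  have hpot : ∀ h, ∑ n ∈ Finset.range T, Ψ h n ≤ 2 * C * (2 + 4 / γ * Real.log (1 + T)) := by
    intro h
    simp only [hΨ]
    rw [← Summable.tsum_finsetSum fun n _ => hsummable h n]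
    have h1 := ((hμ1 h).mul_left (2 * C)).mul_right (2 + 4 / γ * Real.log (1 + T))
    rw [mul_one] at h1
    refine hasSum_le (fun p => ?_) (summable_sum fun n _ => hsummable h n).hasSum h1
    exact sum_potential_le hγ (fun n => ENNReal.toReal_nonneg) (fun n => hμ _ (hfsF n) h p) T
  have hone : ∑ n ∈ Finset.range T, (if n = 0 then (1 : ℝ) else 0) ≤ 1 := by
    rw [Finset.sum_ite_eq' (Finset.range T) 0]
    split_ifs <;> norm_num
  have hsl : 0 ≤ 2 * s / l := by positivity
  calc M.regret dstar.toPolicy (playedPolicy π rule D)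
      ≤ ∑ t : Fin T, ((if (t : ℕ) = 0 then 1 else 0) + 2 * l + 2 * s / l * ((t : ℕ) : ℝ)⁻¹ +
          92 * H * γ * s + 21 * ∑ h, Ψ h t) := Finset.sum_le_sum fun t _ => hgap t
    _ = ∑ n ∈ Finset.range T, (if n = 0 then (1 : ℝ) else 0) + T * (2 * l) +
          2 * s / l * ∑ n ∈ Finset.range T, (n : ℝ)⁻¹ + T * (92 * H * γ * s) +
          21 * ∑ h, ∑ n ∈ Finset.range T, Ψ h n := by
        rw [Fin.sum_univ_eq_sum_range (fun n => (if n = 0 then (1 : ℝ) else 0) + 2 * l +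
          2 * s / l * (n : ℝ)⁻¹ + 92 * H * γ * s + 21 * ∑ h, Ψ h n)]
        simp only [Finset.sum_add_distrib, ← Finset.mul_sum, Finset.sum_const, Finset.card_range,
          nsmul_eq_mul]
        rw [Finset.sum_comm]
        ring
    _ ≤ 1 + T * (2 * l) + 2 * s / l * (1 + Real.log T) + T * (92 * H * γ * s) +
          21 * ∑ _h : Fin H, 2 * C * (2 + 4 / γ * Real.log (1 + T)) := by
        have h1 := mul_le_mul_of_nonneg_left (sum_inv_le T) hsl
        have h2 := Finset.sum_le_sum fun h (_ : h ∈ Finset.univ) => hpot h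
        linarith
    _ = _ := by
        simp only [Finset.sum_const, Finset.card_univ, Fintype.card_fin, nsmul_eq_mul]
        ring

end RegretBound

/-! ### Choice of the parameters -/

section Parameters

/-- The regret bound with `γ = √(C / (T L))` and `l = √(L / T)`. The hypotheses `C ≤ T L` and
`L ≤ T` exclude the cases in which the trivial bound `T` is good enough. -/
theorem regret_bound_arith {T H C L s γ l : ℝ} (hT : 1 ≤ T) (hH : 1 ≤ H) (hC : 1 ≤ C)
    (hL : 1 / 2 ≤ L) (hCT : C ≤ T * L) (hγ : γ = √(C / (T * L))) (hl : l = √(L / T))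
    (hs : s = L + Real.log (6 * (T * H))) :
    1 + 2 * T * l + 2 * s / l * (1 + Real.log T) + 92 * H * T * γ * s +
        42 * H * C * (2 + 4 / γ * Real.log (1 + T)) ≤
      1000 * Real.log (Real.exp 1 + H * T) ^ 2 * (H * √(C * T * L)) := by
  have hT0 : 0 < T := by linarith
  have hH0 : 0 < H := by linarith
  have hC0 : 0 < C := by linarith
  have hL0 : 0 < L := by linarith
  have he : 0 < Real.exp 1 := Real.exp_pos 1
  set k := Real.log (Real.exp 1 + H * T) with hk
  set S := √(C * T * L) with hS
  set r := √(T * L) with hr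
  have hHT : 1 ≤ H * T := one_le_mul_of_one_le_of_one_le hH hT
  have hk1 : 1 ≤ k := by
    rw [hk, Real.le_log_iff_exp_le (by positivity)]
    linarith
  have hγ0 : 0 < γ := by rw [hγ]; positivity
  have hl0 : 0 < l := by rw [hl]; positivity
  have hS0 : 0 < S := by rw [hS]; positivity
  have hr0 : 0 < r := by rw [hr]; positivity
  have hrS : r ≤ S := Real.sqrt_le_sqrt (by
    rw [mul_assoc]
    exact le_mul_of_one_le_left (by positivity) hC)
  have h1 : γ * (T * L) = S := by
    rw [hγ, hS, show C * T * L = C / (T * L) * (T * L) ^ 2 by field_simp,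
      Real.sqrt_mul (by positivity), Real.sqrt_sq (by positivity)]
  have h2 : C / γ = S := by
    rw [div_eq_iff hγ0.ne', hS, hγ, ← Real.sqrt_mul (by positivity),
      show C * T * L * (C / (T * L)) = C ^ 2 by field_simp, Real.sqrt_sq hC0.le]
  have h3 : T * l = r := by
    rw [hl, hr, show T * L = L / T * T ^ 2 by field_simp, Real.sqrt_mul (by positivity),
      Real.sqrt_sq hT0.le, mul_comm]
  have h4 : L / l = r := by
    rw [div_eq_iff hl0.ne', hl, hr, ← Real.sqrt_mul (by positivity),
      show T * L * (L / T) = L ^ 2 by field_simp, Real.sqrt_sq hL0.le]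
  have hCS : C ≤ S := by
    rw [hS]
    refine Real.le_sqrt_of_sq_le ?_
    nlinarith
  have hS1 : 1 ≤ 2 * S := by
    have : (1 / 2 : ℝ) ≤ S := by
      rw [hS]
      refine Real.le_sqrt_of_sq_le ?_
      have h5 : 1 ≤ C * T := one_le_mul_of_one_le_of_one_le hC hT
      nlinarith
    linarith
  have hlogT : Real.log T ≤ k := Real.log_le_log hT0 (by nlinarith)
  have hlogT1 : Real.log (1 + T) ≤ k := by
    refine Real.log_le_log (by positivity) (add_le_add ?_ (by nlinarith))
    exact (by linarith [Real.add_one_le_exp (1 : ℝ)])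
  have hs7 : s ≤ 7 * L * k := by
    have h5 : Real.log 6 ≤ 2 := by
      rw [Real.log_le_iff_le_exp (by norm_num), show (2 : ℝ) = 1 + 1 by norm_num, Real.exp_add]
      have := Real.exp_one_gt_d9
      nlinarith
    have h6 : Real.log (T * H) ≤ k := Real.log_le_log (by positivity) (by linarith)
    rw [hs, Real.log_mul (by norm_num) (by positivity)]
    nlinarith
  have hk0 : 0 ≤ k := by linarith
  have hkk : k ≤ k ^ 2 := by nlinarith
  have hkk1 : 1 ≤ k ^ 2 := by nlinarith
  have t3 : 2 * s / l * (1 + Real.log T) ≤ 28 * k ^ 2 * S := by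
    have h5 : 2 * s / l ≤ 14 * k * r := by
      calc 2 * s / l ≤ 2 * (7 * L * k) / l := by gcongr
        _ = 14 * k * (L / l) := by ring
        _ = _ := by rw [h4]
    calc 2 * s / l * (1 + Real.log T) ≤ 14 * k * r * (2 * k) :=
          mul_le_mul h5 (by linarith) (by linarith [Real.log_nonneg hT]) (by positivity)
      _ = 28 * k ^ 2 * r := by ring
      _ ≤ _ := by gcongr
  have t4 : 92 * H * T * γ * s ≤ 644 * k ^ 2 * (H * S) := by
    calc 92 * H * T * γ * s ≤ 92 * H * T * γ * (7 * L * k) := by gcongr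
      _ = 644 * k * (H * (γ * (T * L))) := by ring
      _ ≤ 644 * k ^ 2 * (H * (γ * (T * L))) := by gcongr
      _ = _ := by rw [h1]
  have t5 : 42 * H * C * (2 + 4 / γ * Real.log (1 + T)) ≤ 252 * k ^ 2 * (H * S) := by
    calc 42 * H * C * (2 + 4 / γ * Real.log (1 + T))
        = 84 * H * C + 168 * H * (C / γ) * Real.log (1 + T) := by ring
      _ ≤ 84 * H * S + 168 * H * S * k := by rw [h2]; gcongr
      _ = (84 + 168 * k) * (H * S) := by ring
      _ ≤ 252 * k ^ 2 * (H * S) := mul_le_mul_of_nonneg_right (by linarith) (by positivity)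
  have hHS : S ≤ H * S := le_mul_of_one_le_left hS0.le hH
  have hkS : H * S ≤ k ^ 2 * (H * S) := le_mul_of_one_le_left (by positivity) hkk1
  have t3' : 28 * k ^ 2 * S ≤ 28 * k ^ 2 * (H * S) := by gcongr
  linarith

/-- If `T` is large compared with `B = H² C L / ε²` up to logarithms of the problem parameters, then
it is so up to logarithms of `T` as well, and the average regret is at most `ε`. -/
theorem sample_complexity_arith {T H C L ε : ℝ} (hT : 1 ≤ T) (hH : 1 ≤ H) (hC : 1 ≤ C)
    (hL : 1 / 2 ≤ L) (hε : 0 < ε) (hε1 : ε < 1)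
    (h : 10 ^ 6 * 80 ^ 4 * (H ^ 2 * C / ε ^ 2 * L) *
      Real.log (Real.exp 1 + H * C * L / ε) ^ 4 ≤ T) :
    1000 * Real.log (Real.exp 1 + H * T) ^ 2 * (H * √(C * T * L)) ≤ T * ε := by
  have hT0 : 0 < T := by linarith
  have hH0 : 0 < H := by linarith
  have hC0 : 0 < C := by linarith
  have hL0 : 0 < L := by linarith
  have he : 0 < Real.exp 1 := Real.exp_pos 1
  have he2 : 2 ≤ Real.exp 1 := by linarith [Real.add_one_le_exp (1 : ℝ)]
  set k := Real.log (Real.exp 1 + H * T) with hk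
  set Z := H * C * L / ε with hZ
  set y := Real.log (Real.exp 1 + Z) with hy
  set B := H ^ 2 * C / ε ^ 2 * L with hB
  have hZ0 : 0 < Z := by positivity
  have hB0 : 0 < B := by positivity
  have hk1 : 1 ≤ k := by
    rw [hk, Real.le_log_iff_exp_le (by positivity)]
    linarith [mul_pos hH0 hT0]
  have hy0 : 0 ≤ y := Real.log_nonneg (by linarith)
  -- it suffices to bound the fourth power of the logarithm
  suffices hmain : 10 ^ 6 * B * k ^ 4 ≤ T by
    refine le_of_sq_le_sq ?_ (by positivity)
    rw [mul_pow, mul_pow H, Real.sq_sqrt (by positivity)]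
    calc (1000 * k ^ 2) ^ 2 * (H ^ 2 * (C * T * L)) = 10 ^ 6 * B * k ^ 4 * (T * ε ^ 2) := by
          rw [hB]; field_simp; ring
      _ ≤ T * (T * ε ^ 2) := by gcongr
      _ = (T * ε) ^ 2 := by ring
  rcases le_or_gt k (80 * y) with hky | hky
  · calc 10 ^ 6 * B * k ^ 4 ≤ 10 ^ 6 * B * (80 * y) ^ 4 := by gcongr
      _ = 10 ^ 6 * 80 ^ 4 * B * y ^ 4 := by ring
      _ ≤ T := h
  -- otherwise `H T` exceeds a large power of `Z`, which absorbs everything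
  · set E := Real.exp (k / 2) with hE
    have hE2 : Real.exp 1 + H * T = E ^ 2 := by
      rw [hE, ← Real.exp_nat_mul, show ((2 : ℕ) : ℝ) * (k / 2) = k by push_cast; ring, hk,
        Real.exp_log (by positivity)]
    have hk4 : k ^ 4 ≤ 4096 * E := by
      have h1 : k / 8 ≤ Real.exp (k / 8) := by linarith [Real.add_one_le_exp (k / 8)]
      have h2 := pow_le_pow_left₀ (by positivity) h1 4
      rw [← Real.exp_nat_mul, show ((4 : ℕ) : ℝ) * (k / 8) = k / 2 by push_cast; ring] at h2
      calc k ^ 4 = 4096 * (k / 8) ^ 4 := by ring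
        _ ≤ _ := by gcongr
    have hEZ : (Real.exp 1 + Z) ^ 40 ≤ E := by
      have h1 : Real.exp 1 + Z = Real.exp y := (Real.exp_log (by positivity)).symm
      rw [h1, ← Real.exp_nat_mul, hE]
      exact Real.exp_le_exp.2 (by push_cast; linarith)
    have hEZ3 : 2 ^ 37 * Z ^ 3 ≤ E := by
      refine le_trans ?_ hEZ
      rw [show (40 : ℕ) = 37 + 3 from rfl, pow_add]
      gcongr
      · linarith
      · linarith
    have hE4 : 4 ≤ E := by
      refine le_trans ?_ hEZ
      calc (4 : ℝ) = 2 ^ 2 := by norm_num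
        _ ≤ (Real.exp 1 + Z) ^ 2 := by gcongr; linarith
        _ ≤ _ := pow_le_pow_right₀ (by linarith) (by norm_num)
    have hHB : H * B ≤ 4 * Z ^ 3 := by
      have h1 : 4 * Z ^ 3 = H * B * (4 * C ^ 2 * L ^ 2 / ε) := by
        rw [hZ, hB]; field_simp
      rw [h1]
      refine le_mul_of_one_le_right (by positivity) ?_
      rw [le_div_iff₀ hε, one_mul]
      have h2 : 1 ≤ C ^ 2 := one_le_pow₀ hC
      have h3 : 1 ≤ 4 * L ^ 2 := by nlinarith
      nlinarith
    refine le_of_mul_le_mul_left ?_ hH0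
    have h1 : Real.exp 1 ≤ 8 := by linarith [Real.exp_one_lt_d9]
    have h2 : 0 < Z ^ 3 * E := mul_pos (pow_pos hZ0 3) (Real.exp_pos _)
    have h3 : 4 * 4 ≤ E * E := mul_le_mul hE4 hE4 (by norm_num) (by linarith)
    calc H * (10 ^ 6 * B * k ^ 4) = 10 ^ 6 * (H * B) * k ^ 4 := by ring
      _ ≤ 10 ^ 6 * (4 * Z ^ 3) * (4096 * E) := by gcongr
      _ ≤ 2 ^ 37 * Z ^ 3 * E / 2 := by linarith
      _ ≤ E * E / 2 := by gcongr
      _ ≤ E ^ 2 - Real.exp 1 := by rw [sq]; linarith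
      _ = H * T := by rw [← hE2]; ring

end Parameters

/-! ### Regret and risk -/

section Guarantees

variable {X A : Type*} {H : ℕ} [NeZero H] [MeasurableSpace X] [MeasurableSpace A]
  [Countable X] [DiscreteMeasurableSpace X] [Countable A] [DiscreteMeasurableSpace A]
  {M : MDP X A H} {F : Finset (ValueFn X A H)} {W : Finset (WeightFn X A H)}
  {π : ValueFn X A H → DetPolicy X A H} {dstar : DetPolicy X A H}

theorem MDP.MixtureRealizable.card_pos {T : ℕ} [NeZero T] (hF : F.Nonempty)
    (hW : M.MixtureRealizable F W π T) : 0 < W.card := by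
  obtain ⟨f, hf⟩ := hF
  obtain ⟨w, hw, -⟩ := hW 0 f hf 1 le_rfl (NeZero.pos T) (fun _ => f) fun _ => hf
  exact Finset.card_pos.2 ⟨w, hw⟩

/-- With probability at least `1 - δ` there is no deviation. -/
theorem le_runLaw_no_deviation {g : ValueFn X A H}
    (hF : ∀ f ∈ F, ∀ h x a, f h x a ∈ Set.Icc (0 : ℝ) 1) (hg : g ∈ F)
    (hbell : ∀ h p, M.bellmanError g h p = 0) (hWpos : 0 < W.card) {T : ℕ} [NeZero T]
    {γ l δ : ℝ} (hγ : 0 < γ) (hl0 : 0 ≤ l) (hl1 : l ≤ 1) (hδ : 0 < δ)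
    {rule : (n : ℕ) → Data X A H 1 n → ValueFn X A H}
    (hmem : ∀ n D, rule n D ∈ F) (hmeas : ∀ n f, MeasurableSet {D | rule n D = f}) :
    ENNReal.ofReal (1 - δ) ≤ runLaw M π rule T {D | ∀ t : Fin T, ∀ j, ∑ i : Fin t,
      deviation M F W π g (γ * ((t : ℕ) + 1)) l j
        (selected rule D (Fin.castLE t.isLt.le i)) (D (Fin.castLE t.isLt.le i) 0) ≤
      Real.log (6 * (F.card : ℝ) * (W.card : ℝ) * T * H / δ)} := by
  have := isProbabilityMeasure_runLaw M F π hmem hmeas T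
  have hT : (1 : ℝ) ≤ T := by exact_mod_cast NeZero.one_le
  have hH : (1 : ℝ) ≤ H := by exact_mod_cast NeZero.one_le
  have hFc : (1 : ℝ) ≤ F.card := by exact_mod_cast Finset.card_pos.2 ⟨g, hg⟩
  have hWc : (1 : ℝ) ≤ W.card := by exact_mod_cast hWpos
  set N : ℝ := 6 * (F.card : ℝ) * (W.card : ℝ) * T * H with hN
  have hN0 : 0 < N := by positivity
  set bad : Set (Data X A H 1 T) :=
    {D | ∃ q : Fin T × ((Fin H × W) ⊕ (Fin H × W × F) ⊕ (F × Bool)),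
      Real.log (N / δ) ≤ ∑ i : Fin q.1, deviation M F W π g (γ * (((q.1 : ℕ) : ℝ) + 1)) l q.2
        (selected rule D (Fin.castLE q.1.isLt.le i)) (D (Fin.castLE q.1.isLt.le i) 0)} with hbad
  have h1 : runLaw M π rule T bad ≤ ENNReal.ofReal δ := by
    refine (runLaw_exists_deviation_ge_le M hF hg hbell (G := fun n => γ * ((n : ℝ) + 1))
      (fun n => by positivity) hl0 hl1 hmem hmeas T (Real.log (N / δ))).trans ?_
    rw [Real.exp_neg, Real.exp_log (by positivity), inv_div, ← ENNReal.ofReal_natCast,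
      ← ENNReal.ofReal_mul (by positivity)]
    refine ENNReal.ofReal_le_ofReal ?_
    rw [← mul_div_assoc, div_le_iff₀ hN0, mul_comm δ]
    refine mul_le_mul_of_nonneg_right ?_ hδ.le
    push_cast
    have h2 : (W.card : ℝ) * H ≤ F.card * (W.card * H) :=
      le_mul_of_one_le_left (by positivity) hFc
    have h3 : (F.card : ℝ) ≤ F.card * (W.card * H) :=
      le_mul_of_one_le_right (by positivity) (one_le_mul_of_one_le_of_one_le hWc hH)
    have h4 : (H : ℝ) * W.card + (H * (W.card * F.card) + F.card * 2) ≤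
        6 * (F.card * (W.card * H)) := by
      nlinarith [mul_nonneg (mul_nonneg (hFc.trans' zero_le_one) (hWc.trans' zero_le_one))
        (hH.trans' zero_le_one)]
    calc (T : ℝ) * (H * W.card + (H * (W.card * F.card) + F.card * 2))
        ≤ T * (6 * (F.card * (W.card * H))) := by gcongr
      _ = N := by rw [hN]; ring
  have h2 : badᶜ ⊆ {D | ∀ t : Fin T, ∀ j, ∑ i : Fin t,
      deviation M F W π g (γ * ((t : ℕ) + 1)) l j
        (selected rule D (Fin.castLE t.isLt.le i)) (D (Fin.castLE t.isLt.le i) 0) ≤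
      Real.log (N / δ)} := by
    intro D hD t j
    by_contra hcon
    exact hD ⟨(t, j), (not_le.1 hcon).le⟩
  refine le_trans ?_ (measure_mono h2)
  rw [ENNReal.ofReal_sub _ hδ.le, ENNReal.ofReal_one, tsub_le_iff_right]
  calc (1 : ℝ≥0∞) = runLaw M π rule T (badᶜ ∪ bad) := by
        rw [Set.compl_union_self, measure_univ]
    _ ≤ runLaw M π rule T badᶜ + runLaw M π rule T bad := measure_union_le _ _
    _ ≤ _ := add_le_add le_rfl h1

theorem regret_le_nat (hopt : M.IsOptimal dstar.toPolicy)
    (hF : ∀ f ∈ F, ∀ h x a, f h x a ∈ Set.Icc (0 : ℝ) 1) (hπ : IsGreedy F π)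
    (hQ : M.Q dstar.toPolicy ∈ F) {T : ℕ} (q : Fin T → Policy X A H) :
    M.regret dstar.toPolicy q ≤ T := by
  have h := Finset.sum_le_card_nsmul Finset.univ
    (fun t => M.J dstar.toPolicy - M.J (q t)) 1 fun t _ => J_gap_le_one hopt hF hπ hQ (q t)
  rw [Finset.card_univ, Fintype.card_fin, nsmul_eq_mul, mul_one] at h
  exact h

/-- If the optimal value function is the only candidate, then optimal policies are played. -/
theorem regret_eq_zero_of_card_eq_one (hopt : M.IsOptimal dstar.toPolicy)
    (hF : ∀ f ∈ F, ∀ h x a, f h x a ∈ Set.Icc (0 : ℝ) 1) (hπ : IsGreedy F π)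
    (hQ : M.Q dstar.toPolicy ∈ F) (hcard : F.card = 1) {T : ℕ}
    {rule : (n : ℕ) → Data X A H 1 n → ValueFn X A H} (hmem : ∀ n D, rule n D ∈ F)
    (D : Data X A H 1 T) : M.regret dstar.toPolicy (playedPolicy π rule D) = 0 := by
  refine Finset.sum_eq_zero fun t _ => ?_
  have h1 : selected rule D t = M.Q dstar.toPolicy :=
    Finset.card_le_one.1 hcard.le _ (hmem _ _) _ hQ
  change _ - M.J (π (selected rule D t)).toPolicy = 0
  rw [h1, J_greedy_Q hopt hF hπ hQ, sub_self]

theorem half_le_log {F : Finset (ValueFn X A H)} {W : Finset (WeightFn X A H)} {δ : ℝ}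
    (hF : 2 ≤ F.card) (hW : 0 < W.card) (hδ : 0 < δ) (hδ1 : δ < 1) :
    1 / 2 ≤ Real.log ((F.card : ℝ) * (W.card : ℝ) / δ) := by
  have hF' : (2 : ℝ) ≤ F.card := by exact_mod_cast hF
  have hW' : (1 : ℝ) ≤ W.card := by exact_mod_cast hW
  have h1 : 2 ≤ (F.card : ℝ) * (W.card : ℝ) / δ := by
    rw [le_div_iff₀ hδ]
    nlinarith
  have h2 := Real.log_le_log zero_lt_two h1
  linarith [Real.log_two_gt_d9]

theorem one_le_toReal_coverability (hF : F.Nonempty) : 1 ≤ (M.coverability F π).toReal := by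
  have := ENNReal.toReal_mono (M.coverability_ne_top π hF) (M.one_le_coverability π hF)
  simpa using this

/-- The high-probability regret bound. -/
theorem le_runLaw_regret_le (hopt : M.IsOptimal dstar.toPolicy)
    (hF : ∀ f ∈ F, ∀ h x a, f h x a ∈ Set.Icc (0 : ℝ) 1) (hπ : IsGreedy F π)
    {δ : ℝ} (hδ : 0 < δ) (hδ1 : δ < 1) (hQ : M.Q dstar.toPolicy ∈ F) {C L : ℝ}
    (hC : C = (M.coverability F π).toReal)
    (hL : L = Real.log ((F.card : ℝ) * (W.card : ℝ) / δ)) {T : ℕ} [NeZero T]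
    (hW : M.MixtureRealizable F W π T) {rule : (n : ℕ) → Data X A H 1 n → ValueFn X A H}
    (hrule : IsGlowRule ⟨T, 1, √(C / (T * L)), δ⟩ F W π rule) :
    ENNReal.ofReal (1 - δ) ≤ runLaw M π rule T
      {D | M.regret dstar.toPolicy (playedPolicy π rule D) ≤
        1000 * Real.log (Real.exp 1 + H * T) ^ 2 * (H * √(C * T * L))} := by
  have hmem : ∀ n D, rule n D ∈ F := hrule.mem
  have hmeas : ∀ n f, MeasurableSet {D | rule n D = f} := hrule.measurableSet
  have := isProbabilityMeasure_runLaw M F π hmem hmeas T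
  have hWpos := hW.card_pos ⟨_, hQ⟩
  have hT : (1 : ℝ) ≤ T := by exact_mod_cast NeZero.one_le
  have hH : (1 : ℝ) ≤ H := by exact_mod_cast NeZero.one_le
  have hFc : (1 : ℝ) ≤ F.card := by exact_mod_cast Finset.card_pos.2 ⟨_, hQ⟩
  have hWc : (1 : ℝ) ≤ W.card := by exact_mod_cast hWpos
  have hC1 : 1 ≤ C := hC ▸ one_le_toReal_coverability ⟨_, hQ⟩
  have hδ' : ENNReal.ofReal (1 - δ) ≤ 1 := ENNReal.ofReal_le_one.2 (by linarith)
  have hHT : 1 ≤ (H : ℝ) * T := one_le_mul_of_one_le_of_one_le hH hT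
  have hk1 : 1 ≤ Real.log (Real.exp 1 + H * T) := by
    rw [Real.le_log_iff_exp_le (by positivity)]
    linarith
  set k := Real.log (Real.exp 1 + H * T) with hk
  -- if the bound holds for every run, then there is nothing to do
  have htriv : (∀ D, M.regret dstar.toPolicy (playedPolicy π rule (D : Data X A H 1 T)) ≤
      1000 * k ^ 2 * (H * √(C * T * L))) → ENNReal.ofReal (1 - δ) ≤ runLaw M π rule T
      {D | M.regret dstar.toPolicy (playedPolicy π rule D) ≤
        1000 * k ^ 2 * (H * √(C * T * L))} := by
    intro hall
    exact hδ'.trans (measure_univ.symm.le.trans (measure_mono fun D _ => hall D))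
  rcases (Nat.one_le_iff_ne_zero.2 (Finset.card_pos.2 ⟨_, hQ⟩).ne').eq_or_lt with hcard | hcard
  · refine htriv fun D => ?_
    rw [regret_eq_zero_of_card_eq_one hopt hF hπ hQ hcard.symm hmem D]
    positivity
  have hL2 : 1 / 2 ≤ L := hL ▸ half_le_log hcard hWpos hδ hδ1
  have hlarge : ∀ R : ℝ, (T : ℝ) ≤ 2 * R → R ^ 2 ≤ C * T * L →
      ENNReal.ofReal (1 - δ) ≤ runLaw M π rule T
      {D | M.regret dstar.toPolicy (playedPolicy π rule D) ≤
        1000 * k ^ 2 * (H * √(C * T * L))} := by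
    intro R hR hR2
    refine htriv fun D => (regret_le_nat hopt hF hπ hQ _).trans ?_
    have h1 : R ≤ √(C * T * L) := Real.le_sqrt_of_sq_le hR2
    have h2 : √(C * T * L) ≤ H * √(C * T * L) := le_mul_of_one_le_left (Real.sqrt_nonneg _) hH
    have h3 : (2 : ℝ) ≤ 1000 * k ^ 2 := by nlinarith
    calc (T : ℝ) ≤ 2 * (H * √(C * T * L)) := by linarith
      _ ≤ _ := mul_le_mul_of_nonneg_right h3 (by positivity)
  rcases lt_or_ge (T * L) C with hCT | hCT
  · refine hlarge (T * L) (by nlinarith) ?_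
    have : 0 < T * L := by positivity
    nlinarith
  rcases lt_or_ge (T : ℝ) L with hLT | hLT
  · refine hlarge T (by linarith) ?_
    have h1 : (T : ℝ) * T ≤ T * L := by gcongr
    nlinarith
  set l := √(L / T) with hl
  set γ := √(C / (T * L)) with hγ
  set s := Real.log (6 * (F.card : ℝ) * (W.card : ℝ) * T * H / δ) with hs
  have hL0 : 0 < L := by linarith
  have hγ0 : 0 < γ := by rw [hγ]; positivity
  have hl0 : 0 < l := by rw [hl]; positivity
  have hl1 : l ≤ 1 := by
    rw [hl, Real.sqrt_le_one, div_le_one (by positivity)]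
    exact hLT
  have hsL : s = L + Real.log (6 * (T * H)) := by
    rw [hs, hL, ← Real.log_mul (by positivity) (by positivity)]
    congr 1
    ring
  have hs0 : 0 ≤ s := by
    rw [hsL]
    have := Real.log_nonneg (show 1 ≤ 6 * ((T : ℝ) * H) by nlinarith)
    linarith
  refine (le_runLaw_no_deviation (π := π) hF hQ (bellmanError_Q hopt) hWpos hγ0 hl0.le hl1 hδ
    hmem hmeas).trans (measure_mono fun D hD => ?_)
  refine (regret_le_of_no_deviation hopt hF hπ hQ hW hγ0 hl0 hs0 hs hrule hD).trans ?_
  rw [← hC]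
  exact regret_bound_arith hT hH hC1 hL2 hCT hγ hl hsL

theorem risk_uniform {T : ℕ} [NeZero T] (q : Policy X A H) (ρ : Fin T → Policy X A H) :
    M.risk q (PMF.uniformOfFintype (Fin T)) ρ = M.regret q ρ / T := by
  simp only [MDP.risk, MDP.regret, tsum_fintype, PMF.uniformOfFintype_apply, Fintype.card_fin,
    ENNReal.toReal_inv, ENNReal.toReal_natCast, ← Finset.mul_sum]
  ring

/-- The sample complexity bound, as a consequence of the regret bound. -/
theorem le_runLaw_risk_le (hopt : M.IsOptimal dstar.toPolicy)
    (hF : ∀ f ∈ F, ∀ h x a, f h x a ∈ Set.Icc (0 : ℝ) 1) (hπ : IsGreedy F π)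
    {δ : ℝ} (hδ : 0 < δ) (hδ1 : δ < 1) (hQ : M.Q dstar.toPolicy ∈ F) {C L : ℝ}
    (hC : C = (M.coverability F π).toReal)
    (hL : L = Real.log ((F.card : ℝ) * (W.card : ℝ) / δ)) {ε : ℝ} (hε : 0 < ε)
    {T : ℕ} [NeZero T]
    (hTε : 10 ^ 6 * 80 ^ 4 * ((H : ℝ) ^ 2 * C / ε ^ 2 * L) *
      Real.log (Real.exp 1 + H * C * L / ε) ^ 4 ≤ T)
    (hW : M.MixtureRealizable F W π T) {rule : (n : ℕ) → Data X A H 1 n → ValueFn X A H}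
    (hrule : IsGlowRule ⟨T, 1, √(C / (T * L)), δ⟩ F W π rule) :
    ENNReal.ofReal (1 - δ) ≤ runLaw M π rule T
      {D | M.risk dstar.toPolicy (PMF.uniformOfFintype (Fin T)) (playedPolicy π rule D) ≤ ε} := by
  refine (le_runLaw_regret_le hopt hF hπ hδ hδ1 hQ hC hL hW hrule).trans
    (measure_mono fun D hD => ?_)
  have hT : (1 : ℝ) ≤ T := by exact_mod_cast NeZero.one_le
  have hH : (1 : ℝ) ≤ H := by exact_mod_cast NeZero.one_le
  have hT0 : (0 : ℝ) < T := by linarith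
  change M.risk _ _ _ ≤ ε
  rw [risk_uniform, div_le_iff₀ hT0, mul_comm]
  rcases le_or_gt 1 ε with hε1 | hε1
  · have h1 := regret_le_nat hopt hF hπ hQ (playedPolicy π rule D)
    nlinarith
  rcases (Nat.one_le_iff_ne_zero.2 (Finset.card_pos.2 ⟨_, hQ⟩).ne').eq_or_lt with hcard | hcard
  · rw [regret_eq_zero_of_card_eq_one hopt hF hπ hQ hcard.symm hrule.mem D]
    positivity
  · exact hD.trans (sample_complexity_arith hT hH (hC ▸ one_le_toReal_coverability ⟨_, hQ⟩)
      (hL ▸ half_le_log hcard (hW.card_pos ⟨_, hQ⟩) hδ hδ1) hε hε1 hTε)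

end Guarantees

end GLOW

theorem mainTheorem1 :
    -- universal constants: a factor `c` and an exponent `k` of the logarithmic factors
    ∃ (c : ℝ) (k : ℕ), 0 < c ∧
      ∀ (X : Type*) (A : Type*) [Countable X] [MeasurableSpace X] [DiscreteMeasurableSpace X]
        [Countable A] [MeasurableSpace A] [DiscreteMeasurableSpace A]
        (H : ℕ) [NeZero H] (M : GLOW.MDP X A H) (πstar : GLOW.DetPolicy X A H)
        (F : Finset (GLOW.ValueFn X A H)) (W : Finset (GLOW.WeightFn X A H))
        (π : GLOW.ValueFn X A H → GLOW.DetPolicy X A H) (δ : ℝ),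
        M.RewardsNormalized →
        M.IsOptimal πstar.toPolicy →
        (∀ f ∈ F, ∀ h x a, f h x a ∈ Set.Icc (0 : ℝ) 1) →
        GLOW.IsGreedy F π →
        0 < δ → δ < 1 →
        -- value function realizability
        M.Q πstar.toPolicy ∈ F →
        -- the coverability coefficient and the logarithm `log (|F| |W| / δ)`
        ∀ (C L : ℝ), C = (M.coverability F π).toReal →
        L = Real.log ((F.card : ℝ) * (W.card : ℝ) / δ) →
        -- in both parts, the hyperparameters are `K = 1` and `γ = √(C / (T L))`
        -- sample complexity, for `T * K = T` trajectories
        (∀ (ε : ℝ), 0 < ε → ∀ (T : ℕ) [NeZero T],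
          c * ((H : ℝ) ^ 2 * C / ε ^ 2 * L) * Real.log (Real.exp 1 + H * C * L / ε) ^ k ≤ T →
          M.MixtureRealizable F W π T →
          ∀ rule, GLOW.IsGlowRule ⟨T, 1, Real.sqrt (C / (T * L)), δ⟩ F W π rule →
            ENNReal.ofReal (1 - δ) ≤ GLOW.runLaw M π rule T
              {D | M.risk πstar.toPolicy (PMF.uniformOfFintype (Fin T))
                (GLOW.playedPolicy π rule D) ≤ ε}) ∧
        -- regret
        (∀ (T : ℕ) [NeZero T],
          M.MixtureRealizable F W π T →
          ∀ rule, GLOW.IsGlowRule ⟨T, 1, Real.sqrt (C / (T * L)), δ⟩ F W π rule →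
            ENNReal.ofReal (1 - δ) ≤ GLOW.runLaw M π rule T
              {D | M.regret πstar.toPolicy (GLOW.playedPolicy π rule D) ≤
                c * Real.log (Real.exp 1 + H * T) ^ k * (H * Real.sqrt (C * T * L))}) := by
  refine ⟨10 ^ 6 * 80 ^ 4, 4, by norm_num, ?_⟩
  intro X A _ _ _ _ _ _ H _ M πstar F W π δ _ hopt hF hπ hδ hδ1 hQ C L hC hL
  refine ⟨fun ε hε T _ hT hW rule hrule =>
    GLOW.le_runLaw_risk_le hopt hF hπ hδ hδ1 hQ hC hL hε hT hW hrule, fun T _ hW rule hrule => ?_⟩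
  refine (GLOW.le_runLaw_regret_le hopt hF hπ hδ hδ1 hQ hC hL hW hrule).trans
    (measure_mono fun D hD => le_trans (Set.mem_ofPred_eq ▸ hD) ?_)
  have hk : 1 ≤ Real.log (Real.exp 1 + H * T) := by
    rw [Real.le_log_iff_exp_le (by positivity)]
    exact le_add_of_nonneg_right (by positivity)
  refine mul_le_mul_of_nonneg_right ?_ (by positivity)
  exact mul_le_mul (by norm_num) (pow_le_pow_right₀ hk (by norm_num)) (by positivity)
    (by norm_num)
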